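/- Let $a>0$ and $0<\alpha\neq 1$, and let $\rho(x)=\alpha^{2}$ for $0\le x<a$ and $\rho(x)=1$ for $x>a$. Let $q$ be a real-valued function on $[0,\infty)$ with $\int_0^{\infty}(1+x)|q(x)|\,dx<\infty$. Let $\alpha_0,\alpha_1,\alpha_2,\beta_0,\beta_1,\beta_2$ be real numbers with $$\delta_1:=\alpha_0\beta_1-\alpha_1\beta_0\le 0,\qquad \delta_2:=\alpha_0\beta_2-\alpha_2\beta_0\le 0,\qquad \delta_3:=\alpha_1\beta_2-\alpha_2\beta_1\ge 0,$$ and assume that the polynomials $\beta_0+i\beta_1\lambda+\beta_2\lambda^2$ and $\alpha_0+i\alpha_1\lambda+\alpha_2\lambda^2$ have no common zero in the half-plane $\operatorname{Im}\lambda>0$. For $\operatorname{Im}\lambda\ge 0$ let $e(x,\lambda)$ be the Jost solution of $$-y''+q(x)y=\lambda^{2}\rho(x)y,\qquad 0\le x<\infty,$$ that is, the solution ($y$ and $y'$ continuous, $y'$ locally absolutely continuous, the equation holding almost everywhere) with $e^{-i\lambda x}e(x,\lambda)\to 1$ and $e^{-i\lambda x}e'(x,\lambda)\to i\lambda$ as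 $x\to+\infty$, and put $$E(\lambda)=\left(\beta_{0}+i\beta_{1}\lambda+\beta_{2}\lambda^{2}\right)e'(0,\lambda)+\left(\alpha_{0}+i\alpha_{1}\lambda+\alpha_{2}\lambda^{2}\right)e(0,\lambda).$$ Then all zeros of $E$ in the half-plane $\operatorname{Im}\lambda>0$ are simple: at each of them $E$ is analytic and vanishes to order exactly one. -/

import Mathlib

open Set Filter Topology MeasureTheory

noncomputable section

namespace JostProblem

/-- The piecewise constant weight `ρ`: it equals `α ^ 2` to the left of `a` and `1` to the right
of `a`. -/
def weight (α a : ℝ) (x : ℝ) : ℝ := if x < a then α ^ 2 else 1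

/-- `y` solves `-y'' + q y = z ^ 2 ρ y` on the half line `[0, ∞)` in the usual sense for locally
integrable coefficients: `y` is differentiable on `[0, ∞)` (one-sidedly at `0`), `y'` is absolutely
continuous on every `[0, b]`, and for almost every `x > 0` the second derivative of `y` at `x`
exists and equals `q x * y x - z ^ 2 * ρ x * y x`. In particular `y` and `y'` are continuous across
the jump of `ρ`. -/
structure IsSolution (ρ q : ℝ → ℝ) (z : ℂ) (y : ℝ → ℂ) : Prop where
  differentiableOn : DifferentiableOn ℝ y (Ici 0)
  absolutelyContinuous :
    ∀ b : ℝ, 0 ≤ b → AbsolutelyContinuousOnInterval (derivWithin y (Ici 0)) 0 b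
  equation : ∀ᵐ x : ℝ ∂(volume.restrict (Ioi 0)),
    HasDerivAt (derivWithin y (Ici 0)) ((q x : ℂ) * y x - z ^ 2 * (ρ x : ℂ) * y x) x

/-- `y` is a Jost solution: it solves the equation and behaves like `exp (i z x)` at infinity,
together with its first derivative. -/
structure IsJostSolution (ρ q : ℝ → ℝ) (z : ℂ) (y : ℝ → ℂ) : Prop where
  isSolution : IsSolution ρ q z y
  tendsto : Tendsto (fun x : ℝ => Complex.exp (-(Complex.I * z * x)) * y x) atTop (𝓝 1)
  tendsto_deriv :
    Tendsto (fun x : ℝ => Complex.exp (-(Complex.I * z * x)) * derivWithin y (Ici 0) x) atTop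
      (𝓝 (Complex.I * z))

/-- The Jost solution `e(·, z)`. It is meant for `z` in the closed upper half-plane, where its
values on `[0, ∞)` are determined by `IsJostSolution`. -/
def jost (ρ q : ℝ → ℝ) (z : ℂ) : ℝ → ℂ := Classical.epsilon (IsJostSolution ρ q z)

/-- The coefficient `c₀ + i c₁ z + c₂ z ^ 2` of the boundary condition. -/
def boundaryCoeff (c : Fin 3 → ℝ) (z : ℂ) : ℂ :=
  (c 0 : ℂ) + Complex.I * (c 1 : ℂ) * z + (c 2 : ℂ) * z ^ 2

/-- The characteristic function
`E(z) = (β₀ + i β₁ z + β₂ z ^ 2) e'(0, z) + (α₀ + i α₁ z + α₂ z ^ 2) e(0, z)`,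
where `A = (α₀, α₁, α₂)` and `B = (β₀, β₁, β₂)`. -/
def charFun (ρ q : ℝ → ℝ) (A B : Fin 3 → ℝ) (z : ℂ) : ℂ :=
  boundaryCoeff B z * derivWithin (jost ρ q z) (Ici 0) 0 + boundaryCoeff A z * jost ρ q z 0

end JostProblem

end

/-! Write `N = ∫ ρ|e(·,z)|²`, and let `P`, `Q` be the boundary coefficients built from `A`, `B`, so
that `E = Q e'(0) + P e(0)`. At a zero of `E`, `P` and `Q` do not both vanish, so `(e'(0), e(0)) = c
(P, -Q)` for some `c`.

Lagrange's identity is used twice. Applied to `e` and its conjugate, which is the Jost solution at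
`-conj z`, it gives `Re z (2 Im z N + |c|² K) = 0`, where `K` is a combination of the three
determinants. The sign conditions make `K ≥ 0`, and `N > 0`, so `z = iτ` is purely imaginary
(`re_eq_zero_of_charFun_eq_zero`). On the imaginary axis `e` and `c = r` are real. Applied to
`e(·,w)` and `e(·,z)` with `w → z`, the identity expresses `2z ∫ ρ e²` through the `z`-derivatives
of `e(0)` and `e'(0)` (`two_mul_integral_eq_deriv`). If `E'` also vanished, these derivatives could
be eliminated, leaving `r² K + 2τN = 0`, which is impossible (`deriv_charFun_ne_zero`).

The analytic groundwork is that `e` exists, is unique and is holomorphic in `z`. The amplitude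
`e^{-izx} e(x,z)` solves a Volterra equation `f = 1 + T f` on bounded continuous functions, with
potential `q + z²(1 - ρ)`. The operator `1 - T` is invertible (`isUnit_one_sub_kernelOp`) and `T` is
holomorphic in `z`, hence so are the inverse and the amplitude. -/

noncomputable section

namespace JostProblem

open scoped BoundedContinuousFunction

/-! ### Absolute continuity and the fundamental theorem of calculus -/

section AbsolutelyContinuous

variable {E : Type*} [NormedAddCommGroup E] [NormedSpace ℝ E]

/-- A function whose increments are dominated by those of an absolutely continuous function is
absolutely continuous. -/
theorem absolutelyContinuousOnInterval_of_dist_le {X Y : Type*} [PseudoMetricSpace X]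
    [PseudoMetricSpace Y] {f : ℝ → X} {g : ℝ → Y} {a b : ℝ} (K : ℝ)
    (hg : AbsolutelyContinuousOnInterval g a b)
    (h : ∀ x ∈ uIcc a b, ∀ y ∈ uIcc a b, dist (f x) (f y) ≤ K * dist (g x) (g y)) :
    AbsolutelyContinuousOnInterval f a b := by
  have hK := Tendsto.const_mul K hg
  rw [mul_zero] at hK
  refine squeeze_zero' (Eventually.of_forall fun E => Finset.sum_nonneg fun i _ => dist_nonneg)
    ?_ hK
  -- The comparison needs only that the intervals have endpoints in `uIcc a b`, which is the
  -- principal part of the filter.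
  refine Filter.mem_inf_of_right ?_
  rw [mem_principal]
  intro E hE
  change (_ : ℝ) ≤ K * ∑ i ∈ _, _
  rw [Finset.mul_sum]
  exact Finset.sum_le_sum fun i hi => h _ (hE.1 i hi).1 _ (hE.1 i hi).2

theorem absolutelyContinuousOnInterval_integral {f : ℝ → E} {a b c : ℝ}
    (hf : IntervalIntegrable f volume a b) (hc : c ∈ uIcc a b) :
    AbsolutelyContinuousOnInterval (fun x => ∫ t in c..x, f t) a b := by
  refine absolutelyContinuousOnInterval_of_dist_le 1
    (hf.norm.absolutelyContinuousOnInterval_intervalIntegral hc) fun x hx y hy => ?_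
  have h1 : ∀ u ∈ uIcc a b, ∀ v ∈ uIcc a b, IntervalIntegrable f volume u v := fun u hu v hv =>
    hf.mono_set (uIcc_subset_uIcc hu hv)
  rw [one_mul, dist_eq_norm, dist_eq_norm,
    intervalIntegral.integral_interval_sub_left (h1 c hc x hx) (h1 c hc y hy),
    intervalIntegral.integral_interval_sub_left (h1 c hc x hx).norm (h1 c hc y hy).norm,
    Real.norm_eq_abs]
  exact intervalIntegral.norm_integral_le_abs_integral_norm

/-- The fundamental theorem of calculus for absolutely continuous functions. -/
theorem integral_eq_sub_of_ae_hasDerivAt [CompleteSpace E] {F f : ℝ → E} {a b : ℝ}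
    (hF : AbsolutelyContinuousOnInterval F a b) (hf : IntervalIntegrable f volume a b)
    (hd : ∀ᵐ x, x ∈ uIcc a b → HasDerivAt F (f x) x) :
    ∫ x in a..b, f x = F b - F a := by
  have hac := hF.fun_sub (absolutelyContinuousOnInterval_integral hf left_mem_uIcc)
  obtain ⟨C, hC⟩ := hac.const_of_ae_hasDerivAt_zero (by
    filter_upwards [hd, hf.ae_hasDerivAt_integral] with x h1 h2 hx
    simpa using (h1 hx).fun_sub (h2 hx a left_mem_uIcc))
  have ha := hC a left_mem_uIcc
  have hb := hC b right_mem_uIcc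
  simp only [intervalIntegral.integral_same, sub_zero] at ha hb
  rw [ha, ← hb]
  abel

theorem integral_Ioi_eq_sub_of_ae_hasDerivAt [CompleteSpace E] {F f : ℝ → E} {a : ℝ} {L : E}
    (hF : ∀ b, a ≤ b → AbsolutelyContinuousOnInterval F a b) (hf : IntegrableOn f (Ioi a))
    (hd : ∀ᵐ x ∂(volume.restrict (Ioi a)), HasDerivAt F (f x) x)
    (hL : Tendsto F atTop (𝓝 L)) :
    ∫ x in Ioi a, f x = L - F a := by
  refine tendsto_nhds_unique (intervalIntegral_tendsto_integral_Ioi a hf tendsto_id) ?_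
  refine (hL.sub_const (F a)).congr' ?_
  filter_upwards [eventually_ge_atTop a] with b hb
  refine (integral_eq_sub_of_ae_hasDerivAt (hF b hb) ?_ ?_).symm
  · rw [intervalIntegrable_iff_integrableOn_Ioc_of_le hb]
    exact hf.mono_set Ioc_subset_Ioi_self
  · rw [ae_restrict_iff' measurableSet_Ioi] at hd
    have hne : ∀ᵐ x : ℝ, x ≠ a := by simp [ae_iff, measure_singleton]
    filter_upwards [hd, hne] with x hx hxa hxb
    rw [uIcc_of_le hb] at hxb
    exact hx (lt_of_le_of_ne hxb.1 (Ne.symm hxa))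

/-- An absolutely continuous function with a continuous almost everywhere derivative is
differentiable everywhere. -/
theorem hasDerivAt_of_ae_hasDerivAt [CompleteSpace E] {F f : ℝ → E}
    (hF : ∀ a b, AbsolutelyContinuousOnInterval F a b) (hf : Continuous f)
    (hd : ∀ᵐ x, HasDerivAt F (f x) x) (x : ℝ) : HasDerivAt F (f x) x := by
  have h : F = fun y => F 0 + ∫ t in (0 : ℝ)..y, f t := by
    funext y
    rw [integral_eq_sub_of_ae_hasDerivAt (hF 0 y) (hf.intervalIntegrable 0 y)
      (hd.mono fun x hx _ => hx)]
    abel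
  rw [h]
  exact (intervalIntegral.integral_hasDerivAt_right (hf.intervalIntegrable 0 x)
    (hf.stronglyMeasurableAtFilter _ _) hf.continuousAt).const_add _

end AbsolutelyContinuous

/-! ### Integral operators on bounded continuous functions and invertibility of `1 - T` -/

theorem integrable_kernel_mul {v : ℝ → ℂ} (hv : Integrable v) (k f : ℝ →ᵇ ℂ) (x : ℝ) :
    Integrable fun t => k (t - x) * (v t * f t) := by
  have h1 : Integrable fun t => v t * f t := by
    refine (hv.bdd_mul (c := ‖f‖) f.continuous.aestronglyMeasurable
      (Eventually.of_forall f.norm_coe_le_norm)).congr (Eventually.of_forall fun t => mul_comm _ _)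
  exact h1.bdd_mul (c := ‖k‖)
    (k.continuous.comp (continuous_id.sub continuous_const)).aestronglyMeasurable
    (Eventually.of_forall fun t => k.norm_coe_le_norm _)

theorem norm_kernel_mul_le (v : ℝ → ℂ) (k f : ℝ →ᵇ ℂ) (x t : ℝ) :
    ‖k (t - x) * (v t * f t)‖ ≤ ‖v t‖ * (‖k‖ * ‖f‖) := by
  rw [norm_mul, norm_mul]
  calc ‖k (t - x)‖ * (‖v t‖ * ‖f t‖) ≤ ‖k‖ * (‖v t‖ * ‖f‖) := by
        gcongr
        · exact k.norm_coe_le_norm _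
        · exact f.norm_coe_le_norm _
    _ = _ := by ring

/-- The function `x ↦ ∫ k (t - x) v t f t dt`, for bounded continuous `k`, `f` and integrable
`v`. -/
def kernelFun (v : ℝ → ℂ) (hv : Integrable v) (k f : ℝ →ᵇ ℂ) : ℝ →ᵇ ℂ :=
  BoundedContinuousFunction.ofNormedAddCommGroup (fun x => ∫ t, k (t - x) * (v t * f t))
    (continuous_of_dominated (bound := fun t => ‖v t‖ * (‖k‖ * ‖f‖))
      (fun x => (integrable_kernel_mul hv k f x).aestronglyMeasurable)
      (fun x => Eventually.of_forall fun t => norm_kernel_mul_le v k f x t)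
      (hv.norm.mul_const _)
      (Eventually.of_forall fun t =>
        (k.continuous.comp (continuous_const.sub continuous_id)).mul continuous_const))
    ((∫ t, ‖v t‖) * (‖k‖ * ‖f‖)) (fun x => by
      rw [← integral_mul_const]
      exact norm_integral_le_of_norm_le (hv.norm.mul_const _)
        (Eventually.of_forall fun t => norm_kernel_mul_le v k f x t))

theorem kernelFun_apply (v : ℝ → ℂ) (hv : Integrable v) (k f : ℝ →ᵇ ℂ) (x : ℝ) :
    kernelFun v hv k f x = ∫ t, k (t - x) * (v t * f t) := rfl

theorem norm_kernelFun_le (v : ℝ → ℂ) (hv : Integrable v) (k f : ℝ →ᵇ ℂ) :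
    ‖kernelFun v hv k f‖ ≤ (∫ t, ‖v t‖) * ‖k‖ * ‖f‖ := by
  rw [mul_assoc]
  exact BoundedContinuousFunction.norm_ofNormedAddCommGroup_le _ (by positivity) _

/-- `kernelFun` as a continuous bilinear map. -/
def kernelOp (v : ℝ → ℂ) (hv : Integrable v) :
    (ℝ →ᵇ ℂ) →L[ℂ] (ℝ →ᵇ ℂ) →L[ℂ] (ℝ →ᵇ ℂ) :=
  LinearMap.mkContinuous₂
    (LinearMap.mk₂ ℂ (kernelFun v hv)
      (fun k k' f => by
        ext x
        simp only [kernelFun_apply, BoundedContinuousFunction.coe_add, Pi.add_apply, add_mul]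
        exact integral_add (integrable_kernel_mul hv k f x) (integrable_kernel_mul hv k' f x))
      (fun c k f => by
        ext x
        simp only [kernelFun_apply, BoundedContinuousFunction.coe_smul, smul_eq_mul]
        rw [← integral_const_mul]
        congr 1; ext t; ring)
      (fun k f f' => by
        ext x
        simp only [kernelFun_apply, BoundedContinuousFunction.coe_add, Pi.add_apply, mul_add]
        exact integral_add (integrable_kernel_mul hv k f x) (integrable_kernel_mul hv k f' x))
      (fun c k f => by
        ext x
        simp only [kernelFun_apply, BoundedContinuousFunction.coe_smul, smul_eq_mul]
        rw [← integral_const_mul]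
        congr 1; ext t; ring))
    (∫ t, ‖v t‖) (norm_kernelFun_le v hv)

theorem kernelOp_apply (v : ℝ → ℂ) (hv : Integrable v) (k f : ℝ →ᵇ ℂ) (x : ℝ) :
    kernelOp v hv k f x = ∫ t, k (t - x) * (v t * f t) := rfl

/-- With `P t = ∫ s in x..t, p s`, the integrand is `-C⁻¹` times the derivative of `exp (-C P)`, so
the integral telescopes. The gain `C⁻¹` is what makes a weighted Volterra operator contractive. -/
theorem integral_mul_exp_neg_primitive_le {p : ℝ → ℝ} (hp : Integrable p) (h0 : ∀ x, 0 ≤ p x)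
    {C : ℝ} (hC : 0 < C) (x : ℝ) :
    IntegrableOn (fun t => p t * Real.exp (-(C * ∫ s in x..t, p s))) (Ioi x) ∧
      ∫ t in Ioi x, p t * Real.exp (-(C * ∫ s in x..t, p s)) ≤ C⁻¹ := by
  set P : ℝ → ℝ := fun t => ∫ s in x..t, p s with hP
  have hPc : Continuous P := intervalIntegral.continuous_primitive
    (fun a b => hp.intervalIntegrable) x
  have hP0 : ∀ t, x ≤ t → 0 ≤ P t := fun t ht =>
    intervalIntegral.integral_nonneg ht fun s _ => h0 s
  have hint : IntegrableOn (fun t => p t * Real.exp (-(C * P t))) (Ioi x) := by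
    refine Integrable.mul_bdd (c := 1) hp.integrableOn
      (Real.continuous_exp.comp (continuous_const.mul hPc).neg).aestronglyMeasurable ?_
    filter_upwards [ae_restrict_mem measurableSet_Ioi] with t ht
    rw [Real.norm_eq_abs, Real.abs_exp, Real.exp_le_one_iff, neg_nonpos]
    exact mul_nonneg hC.le (hP0 t (le_of_lt ht))
  refine ⟨hint, ?_⟩
  have hlim := intervalIntegral_tendsto_integral_Ioi x hp.integrableOn tendsto_id
  have hF : Tendsto (fun t => Real.exp (-(C * P t))) atTop
      (𝓝 (Real.exp (-(C * ∫ s in Ioi x, p s)))) :=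
    (Real.continuous_exp.tendsto _).comp (hlim.const_mul C).neg
  have hac : ∀ b, x ≤ b → AbsolutelyContinuousOnInterval (fun t => Real.exp (-(C * P t))) x b := by
    intro b hb
    refine absolutelyContinuousOnInterval_of_dist_le C
      (absolutelyContinuousOnInterval_integral (hp.intervalIntegrable (a := x) (b := b))
        left_mem_uIcc) fun s hs t ht => ?_
    rw [uIcc_of_le hb] at hs ht
    -- `exp (-u)` is 1-Lipschitz on `[0, ∞)`, so absolute continuity passes from `P` to `exp (-C
    -- P)`.
    have key : ∀ u ∈ Ici (0 : ℝ), ∀ v ∈ Ici (0 : ℝ),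
        |Real.exp (-u) - Real.exp (-v)| ≤ |u - v| := by
      intro u hu v hv
      wlog huv : u ≤ v generalizing u v
      · rw [abs_sub_comm, abs_sub_comm u v]
        exact this v hv u hu (le_of_not_ge huv)
      have h1 : Real.exp (-v) ≤ Real.exp (-u) := Real.exp_le_exp.2 (by linarith)
      rw [abs_of_nonneg (by linarith), abs_of_nonpos (by linarith)]
      have h2 : Real.exp (-v) = Real.exp (-u) * Real.exp (u - v) := by
        rw [← Real.exp_add]; congr 1; ring
      have h3 := Real.add_one_le_exp (u - v)
      have h4 : Real.exp (-u) ≤ 1 := Real.exp_le_one_iff.2 (by simpa using hu)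
      have h5 := Real.exp_pos (-u)
      rw [h2]
      nlinarith
    rw [Real.dist_eq, Real.dist_eq]
    calc _ ≤ |C * P s - C * P t| := key _ (mul_nonneg hC.le (hP0 s hs.1)) _
          (mul_nonneg hC.le (hP0 t ht.1))
      _ = C * |P s - P t| := by rw [← mul_sub, abs_mul, abs_of_pos hC]
  have hd : ∀ᵐ t ∂(volume.restrict (Ioi x)), HasDerivAt (fun t => Real.exp (-(C * P t)))
      (-C * (p t * Real.exp (-(C * P t)))) t := by
    refine ae_restrict_of_ae ?_
    filter_upwards [_root_.LocallyIntegrable.ae_hasDerivAt_integral hp.locallyIntegrable] with t ht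
    convert ((ht x).const_mul C).fun_neg.exp using 1
    ring
  have h := integral_Ioi_eq_sub_of_ae_hasDerivAt hac (hint.const_mul (-C)) hd hF
  rw [integral_const_mul] at h
  have hx : P x = 0 := intervalIntegral.integral_same
  rw [hx, mul_zero, neg_zero, Real.exp_zero] at h
  have hpos := Real.exp_pos (-(C * ∫ s in Ioi x, p s))
  rw [inv_eq_one_div, le_div_iff₀ hC]
  linarith

theorem isUnit_one_sub_of_opNorm_lt_one {E : Type*} [NormedAddCommGroup E] [NormedSpace ℂ E]
    [CompleteSpace E] {S : E →L[ℂ] E} (hS : ‖S‖ < 1) : IsUnit (1 - S) :=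
  isUnit_one_sub_of_norm_lt_one hS

/-- Since `k` vanishes on `(-∞, 0]`, `T` integrates only over `t > x`. Conjugating by multiplication
with `exp (C ∫₀ˣ ‖v‖)`, `C = ‖k‖ + 1`, brings its norm down to at most `‖k‖ / C < 1`, and the
Neumann series applies with no smallness of `v`. -/
theorem isUnit_one_sub_kernelOp (v : ℝ → ℂ) (hv : Integrable v) (k : ℝ →ᵇ ℂ)
    (hk : ∀ s ≤ 0, k s = 0) : IsUnit (1 - kernelOp v hv k) := by
  set C : ℝ := ‖k‖ + 1 with hCdef
  have hC : 0 < C := by positivity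
  have hN := hv.norm
  set P : ℝ → ℝ := fun x => ∫ t in (0 : ℝ)..x, ‖v t‖ with hP
  have hPc : Continuous P := intervalIntegral.continuous_primitive
    (fun a b => hN.intervalIntegrable) 0
  -- Integrability of `v` bounds `P` on the whole line, so both weights `exp (±C P)` are bounded
  -- multipliers, inverse to each other.
  have hPb : ∀ x, |P x| ≤ ∫ t, ‖v t‖ := fun x => by
    refine (intervalIntegral.norm_integral_le_integral_norm_uIoc (f := fun t => ‖v t‖)
      (a := 0) (b := x) (μ := volume)).trans ?_
    simp only [norm_norm]
    exact setIntegral_le_integral hN (Eventually.of_forall fun t => norm_nonneg _)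
  have hw : ∀ c : ℝ, ∃ w : ℝ →ᵇ ℂ, ∀ x, w x = (Real.exp (c * P x) : ℂ) := fun c =>
    ⟨BoundedContinuousFunction.ofNormedAddCommGroup (fun x => (Real.exp (c * P x) : ℂ))
      (Complex.continuous_ofReal.comp (Real.continuous_exp.comp (continuous_const.mul hPc)))
      (Real.exp (|c| * ∫ t, ‖v t‖)) (fun x => by
        rw [Complex.norm_real, Real.norm_eq_abs, Real.abs_exp]
        refine Real.exp_le_exp.2 ((le_abs_self _).trans ?_)
        rw [abs_mul]
        exact mul_le_mul_of_nonneg_left (hPb x) (abs_nonneg c)), fun x => rfl⟩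
  obtain ⟨w, hw1⟩ := hw C
  obtain ⟨w', hw2⟩ := hw (-C)
  have hww : w * w' = 1 := by
    ext x
    rw [BoundedContinuousFunction.mul_apply, hw1, hw2, ← Complex.ofReal_mul, ← Real.exp_add]
    simp
  set T := kernelOp v hv k with hT
  set W : (ℝ →ᵇ ℂ) →L[ℂ] (ℝ →ᵇ ℂ) := ContinuousLinearMap.mul ℂ _ w with hW
  set W' : (ℝ →ᵇ ℂ) →L[ℂ] (ℝ →ᵇ ℂ) := ContinuousLinearMap.mul ℂ _ w' with hW'
  have h1 : W * W' = 1 := by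
    ext1 f
    change w * (w' * f) = f
    rw [← mul_assoc, hww, one_mul]
  have h2 : W' * W = 1 := by
    ext1 f
    change w' * (w * f) = f
    rw [← mul_assoc, mul_comm w', hww, one_mul]
  have hS : ‖W * T * W'‖ < 1 := by
    refine lt_of_le_of_lt (ContinuousLinearMap.opNorm_le_bound _ (M := ‖k‖ * C⁻¹) (by positivity)
      fun f => ?_) (by rw [← div_eq_mul_inv, div_lt_one hC]; linarith)
    refine (BoundedContinuousFunction.norm_le (by positivity)).2 fun x => ?_
    change ‖(w * kernelOp v hv k (w' * f)) x‖ ≤ _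
    rw [BoundedContinuousFunction.mul_apply, kernelOp_apply, ← integral_const_mul]
    obtain ⟨hi, hle⟩ := integral_mul_exp_neg_primitive_le hN (fun x => norm_nonneg (v x)) hC x
    have hb : ∀ t, ‖w x * (k (t - x) * (v t * (w' * f) t))‖ ≤ (Ioi x).indicator
        (fun t => ‖v t‖ * Real.exp (-(C * ∫ s in x..t, ‖v s‖)) * (‖k‖ * ‖f‖)) t := by
      intro t
      by_cases ht : t ∈ Ioi x
      · rw [indicator_of_mem ht, BoundedContinuousFunction.mul_apply, hw1, hw2]
        have h3 : ∫ s in x..t, ‖v s‖ = P t - P x :=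
          (intervalIntegral.integral_interval_sub_left hN.intervalIntegrable
            hN.intervalIntegrable).symm
        have h4 : Real.exp (-(C * (P t - P x))) = Real.exp (C * P x) * Real.exp (-C * P t) := by
          rw [← Real.exp_add]; congr 1; ring
        rw [h3, h4]
        simp only [norm_mul, Complex.norm_real, Real.norm_eq_abs, Real.abs_exp]
        calc _ ≤ Real.exp (C * P x) * (‖k‖ * (‖v t‖ * (Real.exp (-C * P t) * ‖f‖))) := by
              gcongr
              · exact k.norm_coe_le_norm _
              · exact f.norm_coe_le_norm _
          _ = _ := by ring
      · rw [indicator_of_notMem ht, hk _ (by simpa using ht)]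
        simp
    refine (norm_integral_le_of_norm_le ((integrable_indicator_iff measurableSet_Ioi).2
      (hi.mul_const _)) (Eventually.of_forall hb)).trans ?_
    rw [integral_indicator measurableSet_Ioi, integral_mul_const]
    calc _ ≤ C⁻¹ * (‖k‖ * ‖f‖) := by gcongr
      _ = _ := by ring
  have hu : IsUnit (1 - W * T * W') := isUnit_one_sub_of_opNorm_lt_one hS
  have h3 : 1 - T = W' * (1 - W * T * W') * W := by
    rw [mul_sub, sub_mul, mul_one, h2]
    congr 1
    calc T = (W' * W) * T * (W' * W) := by rw [h2, one_mul, mul_one]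
      _ = _ := by simp only [mul_assoc]
  rw [h3]
  exact ((Units.mk W' W h2 h1).isUnit.mul hu).mul (Units.mk W W' h1 h2).isUnit

/-! ### The exponential kernel and its holomorphy in `z` -/

/-- The kernel `s ↦ exp (2 i z max(s, 0))`; it is set to `0` when `z` is not in the closed upper
half-plane. -/
def expKernel (z : ℂ) : ℝ →ᵇ ℂ :=
  if hz : 0 ≤ z.im then
    BoundedContinuousFunction.ofNormedAddCommGroup
      (fun s : ℝ => Complex.exp (2 * Complex.I * z * (max s 0 : ℝ))) (by fun_prop) 1 (fun s => by
        rw [Complex.norm_exp, Real.exp_le_one_iff]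
        have : 0 ≤ z.im * max s 0 := mul_nonneg hz (le_max_right _ _)
        simp
        linarith)
  else 0

theorem expKernel_apply {z : ℂ} (hz : 0 ≤ z.im) (s : ℝ) :
    expKernel z s = Complex.exp (2 * Complex.I * z * (max s 0 : ℝ)) := by
  rw [expKernel, dif_pos hz]; rfl

theorem norm_exp_I_mul (z : ℂ) (x : ℝ) :
    ‖Complex.exp (Complex.I * z * x)‖ = Real.exp (-z.im * x) := by
  rw [Complex.norm_exp]
  simp

/-- The derivative is taken in the sup norm. The decay `exp (-2τs)` keeps `2is exp (2izs)` bounded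
and dominates the Taylor remainder uniformly in `s ≥ 0`. -/
theorem differentiableAt_expKernel {z : ℂ} (hz : 0 < z.im) : DifferentiableAt ℂ expKernel z := by
  set τ := z.im with hτ
  have hn : ∀ (w : ℂ) (s : ℝ), ‖Complex.exp (2 * Complex.I * w * (s : ℝ))‖ =
      Real.exp (-(2 * w.im * s)) := fun w s => by
    rw [Complex.norm_exp]; simp
  set D : ℝ →ᵇ ℂ := BoundedContinuousFunction.ofNormedAddCommGroup
    (fun s : ℝ => 2 * Complex.I * (max s 0 : ℝ) * Complex.exp (2 * Complex.I * z * (max s 0 : ℝ)))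
    (by fun_prop) τ⁻¹ (fun s => by
      have hs : 0 ≤ max s 0 := le_max_right _ _
      rw [norm_mul, hn]
      simp only [norm_mul, Complex.norm_I, Complex.norm_real, Real.norm_eq_abs, abs_of_nonneg hs,
        Complex.norm_ofNat, mul_one]
      have h1 := Real.add_one_le_exp (2 * τ * max s 0)
      rw [Real.exp_neg, ← hτ, ← div_eq_mul_inv, div_le_iff₀ (Real.exp_pos _),
        inv_mul_eq_div, le_div_iff₀ hz]
      linarith) with hD
  have hDa : ∀ s, D s = 2 * Complex.I * (max s 0 : ℝ) *
      Complex.exp (2 * Complex.I * z * (max s 0 : ℝ)) := fun s => rfl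
  refine HasDerivAt.differentiableAt (f' := D) ?_
  rw [hasDerivAt_iff_isLittleO_nhds_zero]
  refine Asymptotics.IsBigO.trans_isLittleO (g := fun h : ℂ => ‖h‖ ^ 2) ?_
    (Asymptotics.isLittleO_norm_pow_id one_lt_two)
  -- For `‖h‖ < τ/2` the remainder is at most `(2‖h‖σ)² exp (-τσ)`. The bound `(τσ)² ≤ 2 exp (τσ)`
  -- then gives `4 · 2 / τ²`.
  refine Asymptotics.IsBigO.of_bound (8 / τ ^ 2) ?_
  filter_upwards [Metric.ball_mem_nhds (0 : ℂ) (half_pos hz)] with h hh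
  rw [mem_ball_zero_iff] at hh
  have him : |h.im| < τ / 2 := (Complex.abs_im_le_norm h).trans_lt hh
  have hzh : 0 ≤ (z + h).im := by
    rw [Complex.add_im, ← hτ]; linarith [(abs_lt.1 him).1]
  refine (BoundedContinuousFunction.norm_le (by positivity)).2 fun s => ?_
  have e : (expKernel (z + h) - expKernel z - h • D) s =
      Complex.exp (2 * Complex.I * z * (max s 0 : ℝ)) *
        (Complex.exp (2 * Complex.I * h * (max s 0 : ℝ)) -
          ∑ m ∈ Finset.range 2, (2 * Complex.I * h * (max s 0 : ℝ)) ^ m / (m.factorial : ℂ)) := by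
    simp only [BoundedContinuousFunction.coe_sub, Pi.sub_apply, BoundedContinuousFunction.coe_smul,
      expKernel_apply hzh, expKernel_apply hz.le, hDa, smul_eq_mul, Finset.sum_range_succ,
      Finset.sum_range_zero, pow_zero, pow_one, Nat.factorial, Nat.cast_one]
    rw [mul_add (2 * Complex.I) z h, add_mul, Complex.exp_add]
    push_cast
    ring
  have hs : 0 ≤ max s 0 := le_max_right _ _
  set σ := max s 0 with hσ
  rw [e, norm_mul, hn, ← hτ]
  have h1 := Complex.norm_exp_sub_sum_le_norm_mul_exp (2 * Complex.I * h * (σ : ℝ)) 2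
  have h2 : ‖2 * Complex.I * h * (σ : ℂ)‖ = 2 * ‖h‖ * σ := by
    simp [abs_of_nonneg hs]
  rw [h2] at h1
  have h3 : Real.exp (2 * ‖h‖ * σ) ≤ Real.exp (τ * σ) :=
    Real.exp_le_exp.2 (by nlinarith)
  have h4 := Real.quadratic_le_exp_of_nonneg (mul_nonneg hz.le hs)
  have h5 : Real.exp (-(2 * τ * σ)) * Real.exp (τ * σ) = (Real.exp (τ * σ))⁻¹ := by
    rw [← Real.exp_add, ← Real.exp_neg]; congr 1; ring
  have h6 : (τ * σ) ^ 2 * (Real.exp (τ * σ))⁻¹ ≤ 2 := by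
    rw [← div_eq_mul_inv, div_le_iff₀ (Real.exp_pos _)]
    nlinarith [mul_nonneg hz.le hs]
  calc _ ≤ Real.exp (-(2 * τ * σ)) * ((2 * ‖h‖ * σ) ^ 2 * Real.exp (τ * σ)) := by
        gcongr
        exact h1.trans (by gcongr)
    _ = 4 / τ ^ 2 * ((τ * σ) ^ 2 * (Real.exp (τ * σ))⁻¹) * ‖h‖ ^ 2 := by
        rw [← h5]; field_simp
        ring
    _ ≤ 4 / τ ^ 2 * 2 * ‖h‖ ^ 2 := by gcongr
    _ = _ := by rw [Real.norm_eq_abs, abs_of_nonneg (by positivity)]; ring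

/-! ### Tail integrals and exponentials as absolutely continuous functions -/

section Tail

variable {W : ℝ → ℂ}

theorem tail_eq_sub (hW : Integrable W) (x : ℝ) :
    ∫ t in Ioi x, W t = (∫ t in Ioi (0 : ℝ), W t) - ∫ t in (0 : ℝ)..x, W t := by
  rw [← intervalIntegral.integral_Ioi_sub_Ioi' (a := 0) (b := x) hW.integrableOn hW.integrableOn]
  ring

theorem absolutelyContinuousOnInterval_const (c : ℂ) (a b : ℝ) :
    AbsolutelyContinuousOnInterval (fun _ : ℝ => c) a b :=
  ContDiffOn.absolutelyContinuousOnInterval contDiffOn_const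

theorem absolutelyContinuousOnInterval_tail (hW : Integrable W) (a b : ℝ) :
    AbsolutelyContinuousOnInterval (fun x => ∫ t in Ioi x, W t) a b := by
  rw [funext (tail_eq_sub hW)]
  refine (absolutelyContinuousOnInterval_const _ a b).fun_sub ?_
  -- The interval is enlarged to contain the base point `0` of the primitive.
  refine (absolutelyContinuousOnInterval_integral (a := min (min a b) 0) (b := max (max a b) 0)
    hW.intervalIntegrable ?_).mono ?_
  · rw [uIcc_of_le (by simp)]; simp
  · exact uIcc_subset_uIcc (by rw [mem_uIcc]; left; simp) (by rw [mem_uIcc]; left; simp)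

theorem ae_hasDerivAt_tail (hW : Integrable W) :
    ∀ᵐ x, HasDerivAt (fun x => ∫ t in Ioi x, W t) (-W x) x := by
  filter_upwards [_root_.LocallyIntegrable.ae_hasDerivAt_integral hW.locallyIntegrable] with x hx
  rw [funext (tail_eq_sub hW)]
  exact (hx 0).const_sub _

theorem continuous_tail (hW : Integrable W) : Continuous fun x => ∫ t in Ioi x, W t := by
  rw [funext (tail_eq_sub hW)]
  exact continuous_const.sub
    (intervalIntegral.continuous_primitive (fun a b => hW.intervalIntegrable) 0)

end Tail

theorem absolutelyContinuousOnInterval_exp_mul (c : ℂ) (a b : ℝ) :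
    AbsolutelyContinuousOnInterval (fun x : ℝ => Complex.exp (c * x)) a b := by
  refine ContDiffOn.absolutelyContinuousOnInterval (ContDiff.contDiffOn ?_)
  exact Complex.contDiff_exp.comp (contDiff_const.mul Complex.ofRealCLM.contDiff)

theorem hasDerivAt_exp_mul (c : ℂ) (x : ℝ) :
    HasDerivAt (fun x : ℝ => Complex.exp (c * x)) (c * Complex.exp (c * x)) x := by
  have h := ((Complex.ofRealCLM.hasDerivAt (x := x)).const_mul c).cexp
  simpa [mul_comm] using h

theorem absolutelyContinuousOnInterval_mul {f g : ℝ → ℂ} {a b : ℝ}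
    (hf : AbsolutelyContinuousOnInterval f a b) (hg : AbsolutelyContinuousOnInterval g a b) :
    AbsolutelyContinuousOnInterval (fun x => f x * g x) a b :=
  hf.fun_smul hg

/-! ### The Volterra equation and existence of Jost solutions -/

/-- The effective potential `q + z ^ 2 (1 - ρ)` on `(0, ∞)`, extended by `0`. -/
def potential (ρ q : ℝ → ℝ) (z : ℂ) : ℝ → ℂ :=
  (Ioi 0).indicator fun x => (q x : ℂ) + z ^ 2 * ((1 - ρ x : ℝ) : ℂ)

variable {ρ q : ℝ → ℝ} {z : ℂ}

theorem integrable_potential (hq : IntegrableOn q (Ioi 0))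
    (hρ : IntegrableOn (fun x => 1 - ρ x) (Ioi 0)) (z : ℂ) : Integrable (potential ρ q z) :=
  (integrable_indicator_iff measurableSet_Ioi).2 (hq.ofReal.add (hρ.ofReal.const_mul (z ^ 2)))

theorem potential_of_nonpos {x : ℝ} (hx : x ≤ 0) : potential ρ q z x = 0 :=
  indicator_of_notMem (by simpa using hx) _

theorem potential_of_pos {x : ℝ} (hx : 0 < x) :
    potential ρ q z x = (q x : ℂ) + z ^ 2 * ((1 - ρ x : ℝ) : ℂ) :=
  indicator_of_mem (by simpa using hx) _

/-- The kernel `s ↦ (exp (2 i z max(s, 0)) - 1) / (2 i z)`. -/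
def jostKernel (z : ℂ) : ℝ →ᵇ ℂ := (2 * Complex.I * z)⁻¹ • (expKernel z - 1)

theorem jostKernel_apply (hz : 0 ≤ z.im) (s : ℝ) : jostKernel z s =
    (2 * Complex.I * z)⁻¹ * (Complex.exp (2 * Complex.I * z * (max s 0 : ℝ)) - 1) := by
  simp [jostKernel, expKernel_apply hz]

theorem jostKernel_of_nonpos (hz : 0 ≤ z.im) {s : ℝ} (hs : s ≤ 0) : jostKernel z s = 0 := by
  rw [jostKernel_apply hz, max_eq_right hs]
  simp

theorem ne_zero_of_im_pos (hz : 0 < z.im) : z ≠ 0 := by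
  rintro rfl
  simp at hz

theorem integrable_exp_mul (hz : 0 ≤ z.im) {W : ℝ → ℂ} (hW : Integrable W)
    (h0 : ∀ t ≤ 0, W t = 0) :
    Integrable fun t : ℝ => Complex.exp (2 * Complex.I * z * t) * W t := by
  have h : (fun t : ℝ => Complex.exp (2 * Complex.I * z * t) * W t) =
      fun t => expKernel z t * W t := by
    funext t
    rcases le_total t 0 with ht | ht
    · rw [h0 t ht, mul_zero, mul_zero]
    · rw [expKernel_apply hz, max_eq_left ht]
  rw [h]
  exact hW.bdd_mul (expKernel z).continuous.aestronglyMeasurable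
    (Eventually.of_forall (expKernel z).norm_coe_le_norm)

/-- Splitting the kernel takes `x` out of the integrands, so the result can be differentiated in `x`
through tail integrals. Vanishing of `W` on the left offsets the growth of `exp (2izt)` as `t → -∞`.
-/
theorem integral_jostKernel_mul (hz : 0 < z.im) {W : ℝ → ℂ} (hW : Integrable W)
    (h0 : ∀ t ≤ 0, W t = 0) (x : ℝ) :
    ∫ t, jostKernel z (t - x) * W t = (2 * Complex.I * z)⁻¹ *
      (Complex.exp (-(2 * Complex.I * z) * x) *
        (∫ t in Ioi x, Complex.exp (2 * Complex.I * z * t) * W t) - ∫ t in Ioi x, W t) := by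
  have hU := integrable_exp_mul hz.le hW h0
  rw [← integral_const_mul, ← integral_sub (hU.integrableOn.const_mul _) hW.integrableOn,
    ← integral_const_mul, ← integral_indicator measurableSet_Ioi]
  congr 1
  funext t
  by_cases ht : t ∈ Ioi x
  · rw [indicator_of_mem ht, jostKernel_apply hz.le, max_eq_left (by simpa using le_of_lt ht),
      ← mul_assoc (Complex.exp _), ← Complex.exp_add]
    push_cast
    rw [show -(2 * Complex.I * z) * x + 2 * Complex.I * z * t = 2 * Complex.I * z * (t - x) by ring]
    ring
  · rw [indicator_of_notMem ht, jostKernel_of_nonpos hz.le (by simpa using ht), zero_mul]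

theorem tendsto_exp_mul_tail (hz : 0 ≤ z.im) {W : ℝ → ℂ} (hW : Integrable W) :
    Tendsto (fun x : ℝ => Complex.exp (-(2 * Complex.I * z) * x) *
        (∫ t in Ioi x, Complex.exp (2 * Complex.I * z * t) * W t)) atTop (𝓝 0) := by
  refine squeeze_zero_norm (fun x => ?_) (tendsto_integral_Ioi_zero (f := fun t => ‖W t‖)
    (μ := volume) tendsto_id)
  rw [← integral_const_mul]
  refine norm_integral_le_of_norm_le hW.norm.integrableOn ?_
  filter_upwards [ae_restrict_mem measurableSet_Ioi] with t ht
  rw [← mul_assoc, ← Complex.exp_add, norm_mul, Complex.norm_exp]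
  refine mul_le_of_le_one_left (norm_nonneg _) (Real.exp_le_one_iff.2 ?_)
  have h1 : 0 ≤ z.im * (t - x) := mul_nonneg hz (sub_nonneg.2 (le_of_lt ht))
  simp
  linarith

theorem integrable_mul_boundedContinuous {V : ℝ → ℂ} (hV : Integrable V) (f : ℝ →ᵇ ℂ) :
    Integrable fun t => V t * f t :=
  hV.mul_bdd (c := ‖f‖) f.continuous.aestronglyMeasurable
    (Eventually.of_forall f.norm_coe_le_norm)

/-- The Volterra equation for the amplitude `exp (-i z x) e(x, z)` of the Jost solution. -/
def IsAmplitude (ρ q : ℝ → ℝ) (z : ℂ) (f : ℝ →ᵇ ℂ) : Prop :=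
  ∀ x, f x = 1 + ∫ t, jostKernel z (t - x) * (potential ρ q z t * f t)

theorem IsAmplitude.eq (hq : IntegrableOn q (Ioi 0))
    (hρ : IntegrableOn (fun x => 1 - ρ x) (Ioi 0)) (hz : 0 < z.im) {f : ℝ →ᵇ ℂ}
    (hf : IsAmplitude ρ q z f) (x : ℝ) :
    f x = 1 + (2 * Complex.I * z)⁻¹ * (Complex.exp (-(2 * Complex.I * z) * x) *
        (∫ t in Ioi x, Complex.exp (2 * Complex.I * z * t) * (potential ρ q z t * f t)) -
          ∫ t in Ioi x, potential ρ q z t * f t) := by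
  rw [hf x, integral_jostKernel_mul hz
    (integrable_mul_boundedContinuous (integrable_potential hq hρ z) f)]
  intro t ht
  rw [potential_of_nonpos ht, zero_mul]

/-- With `c = iz` and the tails `A`, `B` of `V f` and `exp (2ct) V f`, this is variation of
constants: `y = e^{cx}(1 - A/2c) + e^{-cx} B/2c`. Both tail terms vanish in the limit, which gives
the asymptotics. -/
theorem IsAmplitude.isJostSolution (hq : IntegrableOn q (Ioi 0))
    (hρ : IntegrableOn (fun x => 1 - ρ x) (Ioi 0)) (hz : 0 < z.im) {f : ℝ →ᵇ ℂ}
    (hf : IsAmplitude ρ q z f) :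
    IsJostSolution ρ q z fun x : ℝ => Complex.exp (Complex.I * z * x) * f x := by
  have hfe := hf.eq hq hρ hz
  set V := potential ρ q z with hVdef
  have hW : Integrable fun t => V t * f t :=
    integrable_mul_boundedContinuous (integrable_potential hq hρ z) f
  have hU := integrable_exp_mul hz.le hW (fun t ht => by
    rw [hVdef, potential_of_nonpos ht, zero_mul])
  have htB := tendsto_exp_mul_tail hz.le hW
  have htA := tendsto_integral_Ioi_zero (f := fun t => V t * f t) (μ := volume) tendsto_id
  set c : ℂ := Complex.I * z with hc
  have hc0 : c ≠ 0 := mul_ne_zero Complex.I_ne_zero (ne_zero_of_im_pos hz)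
  have hcc : c * c = -z ^ 2 := by
    rw [hc, mul_mul_mul_comm, Complex.I_mul_I]; ring
  have h2c : 2 * Complex.I * z = 2 * c := by rw [hc]; ring
  rw [h2c] at hfe htB hU
  have hA := absolutelyContinuousOnInterval_tail hW
  have hB := absolutelyContinuousOnInterval_tail hU
  have hA' := ae_hasDerivAt_tail hW
  have hB' := ae_hasDerivAt_tail hU
  have hAc := continuous_tail hW
  have hBc := continuous_tail hU
  simp only [id] at htA
  set A : ℝ → ℂ := fun x => ∫ t in Ioi x, V t * f t with hAdef
  set B : ℝ → ℂ := fun x => ∫ t in Ioi x, Complex.exp (2 * c * t) * (V t * f t)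
    with hBdef
  replace hfe : ∀ x, f x = 1 + (2 * c)⁻¹ * (Complex.exp (-(2 * c) * x) * B x - A x) := hfe
  replace htB : Tendsto (fun x : ℝ => Complex.exp (-(2 * c) * x) * B x) atTop (𝓝 0) := htB
  set y : ℝ → ℂ := fun x => Complex.exp (c * x) * f x with hy
  set D : ℝ → ℂ := fun x => Complex.exp (c * x) * (c - A x / 2) - Complex.exp (-c * x) * (B x / 2)
    with hD
  have hyeq : y = fun x : ℝ => Complex.exp (c * x) * (1 - A x / (2 * c)) +
      Complex.exp (-c * x) * (B x / (2 * c)) := by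
    funext x
    have he : Complex.exp (-c * x) = Complex.exp (c * x) * Complex.exp (-(2 * c) * x) := by
      rw [← Complex.exp_add]; congr 1; ring
    simp only [hy]
    rw [hfe x, he]
    field_simp
    ring
  have hac : ∀ a b, AbsolutelyContinuousOnInterval y a b := fun a b => by
    rw [hyeq]
    refine (absolutelyContinuousOnInterval_mul (absolutelyContinuousOnInterval_exp_mul c a b)
      ((absolutelyContinuousOnInterval_const 1 a b).fun_sub ?_)).fun_add
      (absolutelyContinuousOnInterval_mul (absolutelyContinuousOnInterval_exp_mul (-c) a b) ?_)
    · simp only [div_eq_mul_inv]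
      exact absolutelyContinuousOnInterval_mul (hA a b) (absolutelyContinuousOnInterval_const _ a b)
    · simp only [div_eq_mul_inv]
      exact absolutelyContinuousOnInterval_mul (hB a b) (absolutelyContinuousOnInterval_const _ a b)
  have hacD : ∀ a b, AbsolutelyContinuousOnInterval D a b := fun a b => by
    refine (absolutelyContinuousOnInterval_mul (absolutelyContinuousOnInterval_exp_mul c a b)
      ((absolutelyContinuousOnInterval_const c a b).fun_sub ?_)).fun_sub
      (absolutelyContinuousOnInterval_mul (absolutelyContinuousOnInterval_exp_mul (-c) a b) ?_)
    · simp only [div_eq_mul_inv]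
      exact absolutelyContinuousOnInterval_mul (hA a b) (absolutelyContinuousOnInterval_const _ a b)
    · simp only [div_eq_mul_inv]
      exact absolutelyContinuousOnInterval_mul (hB a b) (absolutelyContinuousOnInterval_const _ a b)
  have hDc : Continuous D := by
    simp only [hD]
    fun_prop
  have hexp : ∀ x : ℝ, Complex.exp (-c * x) * Complex.exp (2 * c * x) = Complex.exp (c * x) :=
    fun x => by rw [← Complex.exp_add]; congr 1; ring
  -- The contributions of `A'` and `B'` cancel, so the almost everywhere derivative is the
  -- continuous function `D` and the derivative exists everywhere.
  have hyd : ∀ x, HasDerivAt y (D x) x := by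
    refine hasDerivAt_of_ae_hasDerivAt hac hDc ?_
    filter_upwards [hA', hB'] with x h1 h2
    rw [hyeq]
    refine (((hasDerivAt_exp_mul c x).fun_mul ((h1.div_const (2 * c)).const_sub 1)).fun_add
      ((hasDerivAt_exp_mul (-c) x).fun_mul (h2.div_const (2 * c)))).congr_deriv ?_
    simp only [hD]
    have := hexp x
    generalize Complex.exp (c * x) = e1 at this ⊢
    generalize Complex.exp (-c * x) = e2 at this ⊢
    generalize Complex.exp (2 * c * x) = e3 at this ⊢
    field_simp
    linear_combination (-V x * f x) * this
  have hDd : ∀ᵐ x, HasDerivAt D (-z ^ 2 * y x + V x * y x) x := by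
    filter_upwards [hA', hB'] with x h1 h2
    refine (((hasDerivAt_exp_mul c x).fun_mul ((h1.div_const 2).const_sub c)).fun_sub
      ((hasDerivAt_exp_mul (-c) x).fun_mul (h2.div_const 2))).congr_deriv ?_
    rw [← hcc, show V x * y x = Complex.exp (c * x) * (V x * f x) by simp only [hy]; ring,
      congrFun hyeq x]
    have := hexp x
    generalize Complex.exp (c * x) = e1 at this ⊢
    generalize Complex.exp (-c * x) = e2 at this ⊢
    generalize Complex.exp (2 * c * x) = e3 at this ⊢
    field_simp
    linear_combination (V x * f x) * this
  have hdw : ∀ x ∈ Ici (0 : ℝ), derivWithin y (Ici 0) x = D x := fun x hx =>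
    (hyd x).hasDerivWithinAt.derivWithin (uniqueDiffOn_Ici 0 x hx)
  have hexp1 : ∀ x : ℝ, Complex.exp (-(c * x)) * Complex.exp (c * x) = 1 := fun x => by
    rw [← Complex.exp_add, neg_add_cancel, Complex.exp_zero]
  refine ⟨⟨fun x _ => (hyd x).differentiableAt.differentiableWithinAt, fun b hb => ?_, ?_⟩, ?_, ?_⟩
  · refine absolutelyContinuousOnInterval_of_dist_le 1 (hacD 0 b) fun s hs t ht => ?_
    rw [uIcc_of_le hb] at hs ht
    rw [hdw s hs.1, hdw t ht.1, one_mul]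
  · rw [ae_restrict_iff' measurableSet_Ioi]
    filter_upwards [hDd] with x hx hx0
    have hV : -z ^ 2 * y x + V x * y x = (q x : ℂ) * y x - z ^ 2 * (ρ x : ℂ) * y x := by
      rw [hVdef, potential_of_pos hx0]
      push_cast
      ring
    rw [← hV]
    refine hx.congr_of_eventuallyEq ?_
    filter_upwards [Ioi_mem_nhds hx0] with t ht
    exact hdw t (mem_Ici.2 (le_of_lt ht))
  · have h : Tendsto f atTop (𝓝 1) := by
      have := ((htB.sub htA).const_mul (2 * c)⁻¹).const_add 1
      simp only [sub_zero, mul_zero, add_zero] at this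
      exact this.congr fun x => (hfe x).symm
    refine h.congr fun x => ?_
    simp only [hy]
    rw [← mul_assoc, hexp1, one_mul]
  · have h : Tendsto (fun x => c - A x / 2 - Complex.exp (-(2 * c) * x) * B x / 2) atTop (𝓝 c) := by
      have := ((htA.div_const 2).const_sub c).sub (htB.div_const 2)
      simpa using this
    refine h.congr' ?_
    filter_upwards [eventually_ge_atTop 0] with x hx
    rw [hdw x hx]
    simp only [hD]
    have h1 := hexp1 x
    have h2 : Complex.exp (-(2 * c) * x) = Complex.exp (-(c * x)) * Complex.exp (-c * x) := by
      rw [← Complex.exp_add]; congr 1; ring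
    rw [h2]
    linear_combination (A x / 2 - c) * h1

/-! ### Uniqueness: every Jost solution solves the Volterra equation -/

namespace IsSolution

variable {y : ℝ → ℂ}

theorem continuousOn (h : IsSolution ρ q z y) : ContinuousOn y (Ici 0) :=
  h.differentiableOn.continuousOn

theorem hasDerivAt (h : IsSolution ρ q z y) {x : ℝ} (hx : 0 < x) :
    HasDerivAt y (derivWithin y (Ici 0) x) x :=
  ((h.differentiableOn x hx.le).hasDerivWithinAt).hasDerivAt (Ici_mem_nhds hx)

/-- The derivative is absolutely continuous, hence bounded, on `[0, b]`, so `y` is Lipschitz there.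
-/
theorem absolutelyContinuousOnInterval (h : IsSolution ρ q z y) {b : ℝ} (hb : 0 ≤ b) :
    AbsolutelyContinuousOnInterval y 0 b := by
  obtain ⟨C, hC⟩ := (h.absolutelyContinuous b hb).exists_bound
  rw [uIcc_of_le hb] at hC
  refine LipschitzOnWith.absolutelyContinuousOnInterval (K := C.toNNReal) ?_
  rw [uIcc_of_le hb]
  refine Convex.lipschitzOnWith_of_nnnorm_hasDerivWithin_le (convex_Icc 0 b)
    (f' := derivWithin y (Ici 0)) (fun x hx => ?_) (fun x hx => ?_)
  · exact (h.differentiableOn x hx.1).hasDerivWithinAt.mono Icc_subset_Ici_self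
  · rw [← NNReal.coe_le_coe, coe_nnnorm]
    exact (hC x hx).trans (Real.le_coe_toNNReal C)

end IsSolution

/-- With `c = iz`, the functions `e^{-cx}(y' + cy)` and `e^{cx}(y' - cy)` are primitives of the two
Volterra integrands. Their limits at infinity, `2c` and `0`, evaluate both tails, and substitution
returns `e^{-cx} y`. -/
theorem IsJostSolution.exists_isAmplitude (hq : IntegrableOn q (Ioi 0))
    (hρ : IntegrableOn (fun x => 1 - ρ x) (Ioi 0)) (hz : 0 < z.im) {y : ℝ → ℂ}
    (h : IsJostSolution ρ q z y) :
    ∃ f : ℝ →ᵇ ℂ, IsAmplitude ρ q z f ∧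
      (∀ x : ℝ, 0 ≤ x → y x = Complex.exp (Complex.I * z * x) * f x) ∧
      derivWithin y (Ici 0) 0 = Complex.I * z * f 0 -
        ∫ t, expKernel z t * (potential ρ q z t * f t) := by
  obtain ⟨hs, h1, h2⟩ := h
  set c : ℂ := Complex.I * z with hc
  have hc0 : c ≠ 0 := mul_ne_zero Complex.I_ne_zero (ne_zero_of_im_pos hz)
  have hcc : c * c = -z ^ 2 := by
    rw [hc, mul_mul_mul_comm, Complex.I_mul_I]; ring
  have h2c : 2 * Complex.I * z = 2 * c := by rw [hc]; ring
  set D := derivWithin y (Ici 0) with hD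
  set n : ℝ → ℂ := fun x => Complex.exp (-(c * x)) * y x with hn
  have hexp1 : ∀ x : ℝ, Complex.exp (c * x) * Complex.exp (-(c * x)) = 1 := fun x => by
    rw [← Complex.exp_add, add_neg_cancel, Complex.exp_zero]
  have hnc : ContinuousOn n (Ici 0) :=
    ContinuousOn.mul (Continuous.continuousOn (by fun_prop)) hs.continuousOn
  -- The amplitude is continued to the left of `0` as a constant, only to have a function on the
  -- whole line.
  have hgc : Continuous fun x : ℝ => n (max x 0) :=
    hnc.comp_continuous (by fun_prop) fun x => le_max_right x 0
  obtain ⟨C, hC⟩ : ∃ C, ∀ x : ℝ, ‖n (max x 0)‖ ≤ C := by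
    have hev : ∀ᶠ x in atTop, ‖n x‖ ≤ 2 := by
      have := h1.norm
      rw [norm_one] at this
      exact this.eventually_le_const one_lt_two
    obtain ⟨X, hX⟩ := eventually_atTop.1 hev
    obtain ⟨M, hM⟩ := isCompact_Icc.exists_bound_of_continuousOn
      (hnc.mono (Icc_subset_Ici_self : Icc 0 X ⊆ Ici 0))
    refine ⟨max 2 M, fun x => ?_⟩
    rcases le_total X (max x 0) with hx | hx
    · exact (hX _ hx).trans (le_max_left _ _)
    · exact (hM _ ⟨le_max_right _ _, hx⟩).trans (le_max_right _ _)
  set g : ℝ →ᵇ ℂ := BoundedContinuousFunction.ofNormedAddCommGroup _ hgc C hC with hg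
  have hgn : ∀ x, 0 ≤ x → g x = n x := fun x hx => by
    change n (max x 0) = n x
    rw [max_eq_left hx]
  set V := potential ρ q z with hVdef
  have hV := integrable_potential hq hρ z
  have hW : Integrable fun t => V t * g t := integrable_mul_boundedContinuous hV g
  have hW0 : ∀ t ≤ 0, V t * g t = 0 := fun t ht => by
    rw [hVdef, potential_of_nonpos ht, zero_mul]
  have hU := integrable_exp_mul hz.le hW hW0
  rw [h2c] at hU
  have hDac := hs.absolutelyContinuous
  have hyac : ∀ b, 0 ≤ b → AbsolutelyContinuousOnInterval y 0 b := fun b hb =>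
    hs.absolutelyContinuousOnInterval hb
  have hA : ∀ x : ℝ, 0 ≤ x → ∫ t in Ioi x, V t * g t =
      2 * c - Complex.exp (-c * x) * (D x + c * y x) := by
    intro x hx
    refine integral_Ioi_eq_sub_of_ae_hasDerivAt
      (F := fun x => Complex.exp (-c * x) * (D x + c * y x)) (fun b hb => ?_)
      hW.integrableOn ?_ ?_
    · refine AbsolutelyContinuousOnInterval.mono (a := 0) (b := b) ?_
        (uIcc_subset_uIcc (by rw [uIcc_of_le (hx.trans hb)]; exact ⟨hx, hb⟩) right_mem_uIcc)
      exact absolutelyContinuousOnInterval_mul (absolutelyContinuousOnInterval_exp_mul _ _ _)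
        ((hDac b (hx.trans hb)).fun_add (absolutelyContinuousOnInterval_mul
          (absolutelyContinuousOnInterval_const _ _ _) (hyac b (hx.trans hb))))
    · refine ae_restrict_of_ae_restrict_of_subset (Ioi_subset_Ioi hx) ?_
      filter_upwards [hs.equation, ae_restrict_mem measurableSet_Ioi] with t ht ht0
      refine ((hasDerivAt_exp_mul (-c) t).fun_mul
        (ht.fun_add ((hs.hasDerivAt ht0).const_mul c))).congr_deriv ?_
      rw [hgn t (le_of_lt ht0), hVdef, potential_of_pos ht0, ← hD]
      simp only [hn, ← neg_mul]
      push_cast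
      linear_combination -Complex.exp (-c * t) * y t * hcc
    · have := h2.add (h1.const_mul c)
      rw [mul_one, ← two_mul] at this
      refine this.congr fun t => ?_
      simp only [hn, neg_mul]
      ring
  have hB : ∀ x : ℝ, 0 ≤ x → ∫ t in Ioi x, Complex.exp (2 * c * t) * (V t * g t) =
      0 - Complex.exp (c * x) * (D x - c * y x) := by
    intro x hx
    refine integral_Ioi_eq_sub_of_ae_hasDerivAt
      (F := fun x => Complex.exp (c * x) * (D x - c * y x)) (fun b hb => ?_)
      hU.integrableOn ?_ ?_
    · refine AbsolutelyContinuousOnInterval.mono (a := 0) (b := b) ?_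
        (uIcc_subset_uIcc (by rw [uIcc_of_le (hx.trans hb)]; exact ⟨hx, hb⟩) right_mem_uIcc)
      exact absolutelyContinuousOnInterval_mul (absolutelyContinuousOnInterval_exp_mul _ _ _)
        ((hDac b (hx.trans hb)).fun_sub (absolutelyContinuousOnInterval_mul
          (absolutelyContinuousOnInterval_const _ _ _) (hyac b (hx.trans hb))))
    · refine ae_restrict_of_ae_restrict_of_subset (Ioi_subset_Ioi hx) ?_
      filter_upwards [hs.equation, ae_restrict_mem measurableSet_Ioi] with t ht ht0
      refine ((hasDerivAt_exp_mul c t).fun_mul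
        (ht.fun_sub ((hs.hasDerivAt ht0).const_mul c))).congr_deriv ?_
      have he : Complex.exp (2 * c * t) * Complex.exp (-(c * t)) = Complex.exp (c * t) := by
        rw [← Complex.exp_add]; congr 1; ring
      rw [hgn t (le_of_lt ht0), hVdef, potential_of_pos ht0, ← hD]
      simp only [hn]
      push_cast
      linear_combination -Complex.exp (c * t) * y t * hcc -
        (q t + z ^ 2 * (1 - ρ t)) * y t * he
    -- `e^{-ct}(y' - cy) → 0` by the asymptotics, and `|e^{ct}| ≤ 1 ≤ |e^{-ct}|` for `t ≥ 0`.
    · have h3 := h2.sub (h1.const_mul c)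
      rw [mul_one, sub_self] at h3
      refine squeeze_zero_norm' ?_ (norm_zero (E := ℂ) ▸ h3.norm)
      · filter_upwards [eventually_ge_atTop 0] with t ht
        have he : ‖Complex.exp (c * t)‖ ≤ 1 := by
          rw [hc, norm_exp_I_mul, Real.exp_le_one_iff, neg_mul, neg_nonpos]
          exact mul_nonneg hz.le ht
        have he' : 1 ≤ ‖Complex.exp (-(c * t))‖ := by
          rw [Complex.exp_neg, norm_inv]
          exact (one_le_inv₀ (norm_pos_iff.2 (Complex.exp_ne_zero _))).2 he
        rw [show Complex.exp (-(c * t)) * D t - c * n t =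
          Complex.exp (-(c * t)) * (D t - c * y t) by simp only [hn]; ring, norm_mul, norm_mul]
        exact mul_le_mul_of_nonneg_right (he.trans he') (norm_nonneg _)
  -- `f` is shown to agree with `g` on `[0, ∞)`. As `V` vanishes elsewhere, `V f = V g`, so `f`
  -- solves the equation on all of `ℝ`.
  set f : ℝ →ᵇ ℂ := 1 + kernelOp V hV (jostKernel z) g with hf
  have hfa : ∀ x, f x = 1 + ∫ t, jostKernel z (t - x) * (V t * g t) := fun x => rfl
  have hfg : ∀ x, 0 ≤ x → f x = g x := fun x hx => by
    rw [hfa, integral_jostKernel_mul hz hW hW0, h2c, hA x hx, hB x hx, hgn x hx]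
    have h3 : Complex.exp (-(2 * c) * x) * Complex.exp (c * x) = Complex.exp (-(c * x)) := by
      rw [← Complex.exp_add]; congr 1; ring
    simp only [hn, neg_mul] at h3 ⊢
    field_simp
    linear_combination (c * y x - D x) * h3
  have hfgV : ∀ t, V t * f t = V t * g t := fun t => by
    rcases le_total t 0 with ht | ht
    · rw [hVdef, potential_of_nonpos ht, zero_mul, zero_mul]
    · rw [hfg t ht]
  refine ⟨f, fun x => ?_, fun x hx => ?_, ?_⟩
  · rw [hfa x]
    simp only [← hVdef, hfgV]
  · rw [hfg x hx, hgn x hx]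
    simp only [hn]
    rw [← mul_assoc, hexp1, one_mul]
  · simp only [hfgV]
    have h3 : ∫ t, expKernel z t * (V t * g t) =
        ∫ t in Ioi (0 : ℝ), Complex.exp (2 * c * t) * (V t * g t) := by
      rw [← integral_indicator measurableSet_Ioi]
      congr 1
      funext t
      by_cases ht : t ∈ Ioi (0 : ℝ)
      · rw [indicator_of_mem ht, expKernel_apply hz.le, max_eq_left (le_of_lt ht), h2c]
      · rw [indicator_of_notMem ht, hW0 t (by simpa using ht), mul_zero]
    rw [h3, hB 0 le_rfl, hfg 0 le_rfl, hgn 0 le_rfl]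
    simp [hn]

/-! ### Resolvent of the Volterra operator and holomorphy in `z` -/

section Resolvent

variable {E : Type*} [NormedAddCommGroup E] [NormedSpace ℂ E]

theorem eq_add_apply_iff_eq_inverse_apply {T : E →L[ℂ] E} (h : IsUnit (1 - T)) (e f : E) :
    f = e + T f ↔ f = Ring.inverse (1 - T) e := by
  have h1 : ∀ g, Ring.inverse (1 - T) ((1 - T) g) = g := fun g =>
    DFunLike.congr_fun (Ring.inverse_mul_cancel _ h) g
  have h2 : ∀ g, (1 - T) (Ring.inverse (1 - T) g) = g := fun g =>
    DFunLike.congr_fun (Ring.mul_inverse_cancel _ h) g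
  have h3 : f = e + T f ↔ (1 - T) f = e := by
    rw [← sub_eq_iff_eq_add]; rfl
  rw [h3]
  constructor
  · rintro rfl
    rw [h1]
  · rintro rfl
    rw [h2]

theorem differentiableAt_inverse_one_sub_apply [CompleteSpace E] {T : ℂ → E →L[ℂ] E} {z : ℂ}
    (hT : DifferentiableAt ℂ T z) (h : IsUnit (1 - T z)) (e : E) :
    DifferentiableAt ℂ (fun w => Ring.inverse (1 - T w) e) z := by
  have h1 : DifferentiableAt ℂ (Ring.inverse : (E →L[ℂ] E) → E →L[ℂ] E) (1 - T z) :=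
    differentiableAt_inverse h
  have h2 : DifferentiableAt ℂ (fun w => Ring.inverse (1 - T w)) z :=
    h1.fun_comp' z (hT.const_sub 1)
  exact h2.clm_apply (differentiableAt_const e)

theorem differentiableAt_clm_add_sq_smul_clm {F : Type*} [NormedAddCommGroup F] [NormedSpace ℂ F]
    (L L' : E →L[ℂ] F) {k : ℂ → E} {z : ℂ} (hk : DifferentiableAt ℂ k z) :
    DifferentiableAt ℂ (fun w => L (k w) + w ^ 2 • L' (k w)) z :=
  (L.differentiableAt.fun_comp' z hk).fun_add
    ((differentiableAt_pow 2).fun_smul (L'.differentiableAt.fun_comp' z hk))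

end Resolvent

theorem isUnit_one_sub_jost (hq : IntegrableOn q (Ioi 0))
    (hρ : IntegrableOn (fun x => 1 - ρ x) (Ioi 0)) (hz : 0 ≤ z.im) :
    IsUnit (1 - kernelOp (potential ρ q z) (integrable_potential hq hρ z) (jostKernel z)) :=
  isUnit_one_sub_kernelOp _ _ _ fun _ hs => jostKernel_of_nonpos hz hs

/-- The solution of the Volterra equation for `exp (-i z x) e(x, z)`. -/
def amplitude (hq : IntegrableOn q (Ioi 0)) (hρ : IntegrableOn (fun x => 1 - ρ x) (Ioi 0))
    (z : ℂ) : ℝ →ᵇ ℂ :=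
  Ring.inverse (1 - kernelOp (potential ρ q z) (integrable_potential hq hρ z) (jostKernel z)) 1

theorem isAmplitude_iff (hq : IntegrableOn q (Ioi 0))
    (hρ : IntegrableOn (fun x => 1 - ρ x) (Ioi 0)) (hz : 0 ≤ z.im) {f : ℝ →ᵇ ℂ} :
    IsAmplitude ρ q z f ↔ f = amplitude hq hρ z := by
  rw [amplitude, ← eq_add_apply_iff_eq_inverse_apply (isUnit_one_sub_jost hq hρ hz)]
  exact ⟨fun h => BoundedContinuousFunction.ext h, fun h x => DFunLike.congr_fun h x⟩

/-- The Volterra solution witnesses existence, so the choice made by `Classical.epsilon` is a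
genuine Jost solution. -/
theorem isJostSolution_jost (hq : IntegrableOn q (Ioi 0))
    (hρ : IntegrableOn (fun x => 1 - ρ x) (Ioi 0)) (hz : 0 < z.im) :
    IsJostSolution ρ q z (jost ρ q z) :=
  Classical.epsilon_spec (p := IsJostSolution ρ q z)
    ⟨_, ((isAmplitude_iff hq hρ hz.le).2 rfl).isJostSolution hq hρ hz⟩

/-- Uniqueness of the Volterra solution determines `y` on `[0, ∞)`. Writing `y'(0)` through an
operator applied to the amplitude lets it inherit holomorphy in `z`. -/
theorem IsJostSolution.eq_amplitude (hq : IntegrableOn q (Ioi 0))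
    (hρ : IntegrableOn (fun x => 1 - ρ x) (Ioi 0)) (hz : 0 < z.im) {y : ℝ → ℂ}
    (h : IsJostSolution ρ q z y) :
    (∀ x : ℝ, 0 ≤ x → y x = Complex.exp (Complex.I * z * x) * amplitude hq hρ z x) ∧
      derivWithin y (Ici 0) 0 = Complex.I * z * amplitude hq hρ z 0 -
        kernelOp (potential ρ q z) (integrable_potential hq hρ z) (expKernel z)
          (amplitude hq hρ z) 0 := by
  obtain ⟨f, hf, h1, h2⟩ := h.exists_isAmplitude hq hρ hz
  rw [isAmplitude_iff hq hρ hz.le] at hf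
  subst hf
  refine ⟨h1, ?_⟩
  rw [h2, kernelOp_apply]
  simp only [sub_zero]

/-- On the half line `V_z = V₀ + z²(1 - ρ)`, and `1 - ρ` is the potential for `q = 0`, `z = 1`. This
leaves two bilinear operators independent of `z`, so holomorphy reduces to that of the kernel. -/
theorem kernelOp_potential (hq : IntegrableOn q (Ioi 0))
    (hρ : IntegrableOn (fun x => 1 - ρ x) (Ioi 0)) (z : ℂ) (k : ℝ →ᵇ ℂ) :
    kernelOp (potential ρ q z) (integrable_potential hq hρ z) k =
      kernelOp (potential ρ q 0) (integrable_potential hq hρ 0) k +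
      z ^ 2 • kernelOp (potential ρ (fun _ => 0) 1)
        (integrable_potential (integrableOn_zero) hρ 1) k := by
  ext f x
  change _ = kernelOp (potential ρ q 0) (integrable_potential hq hρ 0) k f x +
      z ^ 2 * kernelOp (potential ρ (fun _ => 0) 1)
        (integrable_potential (integrableOn_zero) hρ 1) k f x
  rw [kernelOp_apply, kernelOp_apply, kernelOp_apply, ← integral_const_mul,
    ← integral_add (integrable_kernel_mul (integrable_potential hq hρ 0) k f x)
      ((integrable_kernel_mul (integrable_potential integrableOn_zero hρ 1) k f x).const_mul _)]
  congr 1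
  funext t
  by_cases ht : 0 < t
  · rw [potential_of_pos ht, potential_of_pos ht, potential_of_pos ht]
    push_cast
    ring
  · rw [potential_of_nonpos (not_lt.1 ht), potential_of_nonpos (not_lt.1 ht),
      potential_of_nonpos (not_lt.1 ht)]
    ring

theorem differentiableAt_kernelOp_potential (hq : IntegrableOn q (Ioi 0))
    (hρ : IntegrableOn (fun x => 1 - ρ x) (Ioi 0)) {k : ℂ → ℝ →ᵇ ℂ}
    (hk : DifferentiableAt ℂ k z) :
    DifferentiableAt ℂ
      (fun w => kernelOp (potential ρ q w) (integrable_potential hq hρ w) (k w)) z := by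
  have h := differentiableAt_clm_add_sq_smul_clm (E := ℝ →ᵇ ℂ)
    (F := (ℝ →ᵇ ℂ) →L[ℂ] (ℝ →ᵇ ℂ)) (kernelOp (potential ρ q 0) (integrable_potential hq hρ 0))
    (kernelOp (potential ρ (fun _ => 0) 1) (integrable_potential integrableOn_zero hρ 1)) hk
  refine h.congr_of_eventuallyEq (Eventually.of_forall fun w => ?_)
  exact kernelOp_potential hq hρ w (k w)

theorem differentiableAt_jostKernel (hz : 0 < z.im) : DifferentiableAt ℂ jostKernel z := by
  have h : DifferentiableAt ℂ (fun w : ℂ => (2 * Complex.I * w)⁻¹) z :=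
    (differentiableAt_id.const_mul _).fun_inv
      (mul_ne_zero (mul_ne_zero two_ne_zero Complex.I_ne_zero) (ne_zero_of_im_pos hz))
  exact h.fun_smul ((differentiableAt_expKernel hz).sub_const 1)

theorem differentiableAt_amplitude (hq : IntegrableOn q (Ioi 0))
    (hρ : IntegrableOn (fun x => 1 - ρ x) (Ioi 0)) (hz : 0 < z.im) :
    DifferentiableAt ℂ (amplitude hq hρ) z :=
  differentiableAt_inverse_one_sub_apply
    (differentiableAt_kernelOp_potential hq hρ (differentiableAt_jostKernel hz))
    (isUnit_one_sub_jost hq hρ hz.le) 1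

theorem eventually_im_pos (hz : 0 < z.im) : ∀ᶠ w in 𝓝 z, 0 < w.im :=
  (isOpen_lt continuous_const Complex.continuous_im).mem_nhds hz

theorem differentiableAt_jost_zero (hq : IntegrableOn q (Ioi 0))
    (hρ : IntegrableOn (fun x => 1 - ρ x) (Ioi 0)) (hz : 0 < z.im) :
    DifferentiableAt ℂ (fun w => jost ρ q w 0) z := by
  have h : DifferentiableAt ℂ (fun w => amplitude hq hρ w 0) z :=
    (BoundedContinuousFunction.evalCLM ℂ (0 : ℝ)).differentiableAt.fun_comp' z
      (differentiableAt_amplitude hq hρ hz)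
  refine h.congr_of_eventuallyEq ?_
  filter_upwards [eventually_im_pos hz] with w hw
  rw [((isJostSolution_jost hq hρ hw).eq_amplitude hq hρ hw).1 0 le_rfl]
  simp

theorem differentiableAt_derivWithin_jost_zero (hq : IntegrableOn q (Ioi 0))
    (hρ : IntegrableOn (fun x => 1 - ρ x) (Ioi 0)) (hz : 0 < z.im) :
    DifferentiableAt ℂ (fun w => derivWithin (jost ρ q w) (Ici 0) 0) z := by
  have hm := differentiableAt_amplitude hq hρ hz
  have h1 : DifferentiableAt ℂ (fun w => amplitude hq hρ w 0) z :=
    (BoundedContinuousFunction.evalCLM ℂ (0 : ℝ)).differentiableAt.fun_comp' z hm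
  have h2 : DifferentiableAt ℂ (fun w => kernelOp (potential ρ q w)
      (integrable_potential hq hρ w) (expKernel w) (amplitude hq hρ w) 0) z :=
    (BoundedContinuousFunction.evalCLM ℂ (0 : ℝ)).differentiableAt.fun_comp' z
      ((differentiableAt_kernelOp_potential hq hρ (differentiableAt_expKernel hz)).clm_apply hm)
  have h3 : DifferentiableAt ℂ (fun w : ℂ => Complex.I * w) z := differentiableAt_id.const_mul _
  refine ((h3.fun_mul h1).fun_sub h2).congr_of_eventuallyEq ?_
  filter_upwards [eventually_im_pos hz] with w hw
  exact ((isJostSolution_jost hq hρ hw).eq_amplitude hq hρ hw).2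

theorem tendsto_jost (hq : IntegrableOn q (Ioi 0))
    (hρ : IntegrableOn (fun x => 1 - ρ x) (Ioi 0)) (hz : 0 < z.im) {x : ℝ} (hx : 0 ≤ x) :
    Tendsto (fun w => jost ρ q w x) (𝓝 z) (𝓝 (jost ρ q z x)) := by
  have h1 : ContinuousAt (fun w => Complex.exp (Complex.I * w * x) * amplitude hq hρ w x) z := by
    refine ContinuousAt.mul (Continuous.continuousAt (by fun_prop)) ?_
    exact ((BoundedContinuousFunction.evalCLM ℂ x).continuous.continuousAt).comp
      (f := amplitude hq hρ) (differentiableAt_amplitude hq hρ hz).continuousAt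
  rw [((isJostSolution_jost hq hρ hz).eq_amplitude hq hρ hz).1 x hx]
  refine h1.tendsto.congr' ?_
  filter_upwards [eventually_im_pos hz] with w hw
  exact (((isJostSolution_jost hq hρ hw).eq_amplitude hq hρ hw).1 x hx).symm

/-! ### Decay, Lagrange's identity and its two applications -/

theorem norm_jost_le (hq : IntegrableOn q (Ioi 0))
    (hρ : IntegrableOn (fun x => 1 - ρ x) (Ioi 0)) (hz : 0 < z.im) {x : ℝ} (hx : 0 ≤ x) :
    ‖jost ρ q z x‖ ≤ ‖amplitude hq hρ z‖ * Real.exp (-z.im * x) := by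
  rw [((isJostSolution_jost hq hρ hz).eq_amplitude hq hρ hz).1 x hx, norm_mul, norm_exp_I_mul,
    mul_comm]
  exact mul_le_mul_of_nonneg_right ((amplitude hq hρ z).norm_coe_le_norm x) (Real.exp_pos _).le

theorem integrableOn_weight_mul_exp (hρ : IntegrableOn (fun x => 1 - ρ x) (Ioi 0)) {τ : ℝ}
    (hτ : 0 < τ) : IntegrableOn (fun x => ρ x * Real.exp (-τ * x)) (Ioi 0) := by
  have h1 : IntegrableOn (fun x : ℝ => Real.exp (-τ * x)) (Ioi 0) :=
    integrableOn_exp_mul_Ioi (neg_lt_zero.2 hτ) 0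
  have h2 : IntegrableOn (fun x => (1 - ρ x) * Real.exp (-τ * x)) (Ioi 0) := by
    refine Integrable.mul_bdd (c := 1) hρ (by fun_prop) ?_
    filter_upwards [ae_restrict_mem measurableSet_Ioi] with x hx
    rw [Real.norm_eq_abs, Real.abs_exp, Real.exp_le_one_iff, neg_mul, neg_nonpos]
    exact mul_nonneg hτ.le (le_of_lt hx)
  refine (h1.sub h2).congr (Eventually.of_forall fun x => ?_)
  simp only [Pi.sub_apply]
  ring

theorem aestronglyMeasurable_weight (hρ : IntegrableOn (fun x => 1 - ρ x) (Ioi 0)) :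
    AEStronglyMeasurable (fun x => (ρ x : ℂ)) (volume.restrict (Ioi 0)) := by
  have h : AEStronglyMeasurable ρ (volume.restrict (Ioi 0)) := by
    refine (aestronglyMeasurable_const.sub hρ.aestronglyMeasurable).congr
      (f := fun x => 1 - (1 - ρ x)) (Eventually.of_forall fun x => ?_)
    ring
  exact Complex.continuous_ofReal.comp_aestronglyMeasurable h

theorem IsSolution.aestronglyMeasurable {y : ℝ → ℂ} (h : IsSolution ρ q z y) :
    AEStronglyMeasurable y (volume.restrict (Ioi 0)) :=
  (h.continuousOn.mono Ioi_subset_Ici_self).aestronglyMeasurable measurableSet_Ioi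

/-- Lagrange's identity on the half line. -/
theorem lagrange_identity {w : ℂ} (hz : 0 < z.im) (hw : 0 < w.im) {y u : ℝ → ℂ}
    (hy : IsJostSolution ρ q z y) (hu : IsJostSolution ρ q w u)
    (hint : IntegrableOn (fun x => (ρ x : ℂ) * (y x * u x)) (Ioi 0)) :
    (z ^ 2 - w ^ 2) * ∫ x in Ioi 0, (ρ x : ℂ) * (y x * u x) =
      derivWithin y (Ici 0) 0 * u 0 - y 0 * derivWithin u (Ici 0) 0 := by
  set D := derivWithin y (Ici 0) with hD
  set G := derivWithin u (Ici 0) with hG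
  have h := integral_Ioi_eq_sub_of_ae_hasDerivAt (F := fun x => D x * u x - y x * G x) (a := 0)
    (f := fun x => (w ^ 2 - z ^ 2) * ((ρ x : ℂ) * (y x * u x))) (L := 0)
    (fun b hb => (absolutelyContinuousOnInterval_mul (hy.isSolution.absolutelyContinuous b hb)
      (hu.isSolution.absolutelyContinuousOnInterval hb)).fun_sub
        (absolutelyContinuousOnInterval_mul (hy.isSolution.absolutelyContinuousOnInterval hb)
          (hu.isSolution.absolutelyContinuous b hb))) (hint.const_mul _) ?_ ?_
  · rw [integral_const_mul] at h
    linear_combination -h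
  · filter_upwards [hy.isSolution.equation, hu.isSolution.equation,
      ae_restrict_mem measurableSet_Ioi] with x h1 h2 hx
    refine ((h1.fun_mul (hu.isSolution.hasDerivAt hx)).fun_sub
      ((hy.isSolution.hasDerivAt hx).fun_mul h2)).congr_deriv ?_
    rw [← hD, ← hG]
    ring
  · have h1 := (hy.tendsto_deriv.mul hu.tendsto).sub (hy.tendsto.mul hu.tendsto_deriv)
    have h2 : Tendsto (fun x : ℝ => Complex.exp (Complex.I * (z + w) * x)) atTop (𝓝 0) := by
      refine squeeze_zero_norm (a := fun x : ℝ => Real.exp (-(z + w).im * x))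
        (fun x => (norm_exp_I_mul _ _).le) ?_
      refine Real.tendsto_exp_atBot.comp (tendsto_id.const_mul_atTop_of_neg ?_)
      rw [Complex.add_im]
      linarith
    have h3 := h2.mul h1
    rw [zero_mul] at h3
    refine h3.congr fun x => ?_
    have e : Complex.exp (Complex.I * (z + w) * x) * (Complex.exp (-(Complex.I * z * x)) *
        Complex.exp (-(Complex.I * w * x))) = 1 := by
      rw [← Complex.exp_add, ← Complex.exp_add, ← Complex.exp_zero]; congr 1; ring
    rw [← hD, ← hG]
    linear_combination (D x * u x - y x * G x) * e

open ComplexConjugate in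
-- `ρ` and `q` are real and `conj (iz) = i(-conj z)`. Reflection in the imaginary axis preserves the
-- upper half-plane, so uniqueness applies to the conjugate solution.
theorem IsJostSolution.conj {y : ℝ → ℂ} (h : IsJostSolution ρ q z y) :
    IsJostSolution ρ q (-conj z) (fun x => conj (y x)) ∧
      derivWithin (fun x => conj (y x)) (Ici 0) = fun x => conj (derivWithin y (Ici 0) x) := by
  have hd : derivWithin (fun x => conj (y x)) (Ici 0) =
      fun x => conj (derivWithin y (Ici 0) x) := by
    funext x
    exact derivWithin.star
  have he : ∀ x : ℝ, Complex.exp (-(Complex.I * -conj z * x)) =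
      conj (Complex.exp (-(Complex.I * z * x))) := fun x => by
    rw [← Complex.exp_conj]
    congr 1
    simp
  refine ⟨⟨⟨fun x hx => (h.isSolution.differentiableOn x hx).star, fun b hb => ?_, ?_⟩, ?_, ?_⟩, hd⟩
  · rw [hd]
    refine absolutelyContinuousOnInterval_of_dist_le 1 (h.isSolution.absolutelyContinuous b hb)
      fun s _ t _ => ?_
    rw [one_mul, Complex.dist_conj_conj]
  · filter_upwards [h.isSolution.equation] with x hx
    rw [hd]
    refine hx.star.congr_deriv ?_
    simp
  · simp only [he, ← map_mul]
    have := (Complex.continuous_conj.tendsto _).comp h.tendsto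
    simpa [Function.comp_def] using this
  · simp only [hd, he, ← map_mul]
    have := (Complex.continuous_conj.tendsto _).comp h.tendsto_deriv
    simpa [Function.comp_def] using this

theorem IsJostSolution.eq_jost (hq : IntegrableOn q (Ioi 0))
    (hρ : IntegrableOn (fun x => 1 - ρ x) (Ioi 0)) (hz : 0 < z.im) {y : ℝ → ℂ}
    (h : IsJostSolution ρ q z y) : (∀ x : ℝ, 0 ≤ x → y x = jost ρ q z x) ∧
      derivWithin y (Ici 0) 0 = derivWithin (jost ρ q z) (Ici 0) 0 := by
  have h1 := h.eq_amplitude hq hρ hz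
  have h2 := (isJostSolution_jost hq hρ hz).eq_amplitude hq hρ hz
  exact ⟨fun x hx => (h1.1 x hx).trans (h2.1 x hx).symm, h1.2.trans h2.2.symm⟩

/-- The decay comes from the factor at the fixed `z` alone, so the majorant is uniform in `w` near
`z`, as dominated convergence requires. -/
theorem norm_weight_mul_jost_mul_jost_le (hq : IntegrableOn q (Ioi 0))
    (hρ : IntegrableOn (fun x => 1 - ρ x) (Ioi 0)) (hρ0 : ∀ x, 0 < ρ x) (hz : 0 < z.im) {w : ℂ}
    (hw : 0 < w.im) {C : ℝ} (hC : ‖amplitude hq hρ w‖ ≤ C) {x : ℝ} (hx : 0 < x) :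
    ‖(ρ x : ℂ) * (jost ρ q w x * jost ρ q z x)‖ ≤
      ρ x * Real.exp (-z.im * x) * (C * ‖amplitude hq hρ z‖) := by
  have h1 : ‖jost ρ q w x‖ ≤ C := by
    refine (norm_jost_le hq hρ hw hx.le).trans ?_
    refine (mul_le_of_le_one_right (norm_nonneg _) (Real.exp_le_one_iff.2 ?_)).trans hC
    nlinarith
  have h2 := norm_jost_le hq hρ hz hx.le
  rw [norm_mul, norm_mul, Complex.norm_real, Real.norm_eq_abs, abs_of_pos (hρ0 x)]
  calc _ ≤ ρ x * (C * (‖amplitude hq hρ z‖ * Real.exp (-z.im * x))) := by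
        have := (hρ0 x).le
        have := (norm_nonneg _).trans h1
        gcongr
    _ = _ := by ring

theorem aestronglyMeasurable_weight_mul_jost_mul_jost (hq : IntegrableOn q (Ioi 0))
    (hρ : IntegrableOn (fun x => 1 - ρ x) (Ioi 0)) (hz : 0 < z.im) {w : ℂ} (hw : 0 < w.im) :
    AEStronglyMeasurable (fun x => (ρ x : ℂ) * (jost ρ q w x * jost ρ q z x))
      (volume.restrict (Ioi 0)) :=
  (aestronglyMeasurable_weight hρ).mul
    ((isJostSolution_jost hq hρ hw).isSolution.aestronglyMeasurable.mul
      (isJostSolution_jost hq hρ hz).isSolution.aestronglyMeasurable)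

theorem integrableOn_weight_mul_jost_mul_jost (hq : IntegrableOn q (Ioi 0))
    (hρ : IntegrableOn (fun x => 1 - ρ x) (Ioi 0)) (hρ0 : ∀ x, 0 < ρ x) (hz : 0 < z.im) {w : ℂ}
    (hw : 0 < w.im) :
    IntegrableOn (fun x => (ρ x : ℂ) * (jost ρ q w x * jost ρ q z x)) (Ioi 0) := by
  refine Integrable.mono' ((integrableOn_weight_mul_exp hρ hz).mul_const
    (‖amplitude hq hρ w‖ * ‖amplitude hq hρ z‖))
    (aestronglyMeasurable_weight_mul_jost_mul_jost hq hρ hz hw) ?_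
  filter_upwards [ae_restrict_mem measurableSet_Ioi] with x hx
  exact norm_weight_mul_jost_mul_jost_le hq hρ hρ0 hz hw le_rfl hx

theorem tendsto_integral_weight_mul_jost (hq : IntegrableOn q (Ioi 0))
    (hρ : IntegrableOn (fun x => 1 - ρ x) (Ioi 0)) (hρ0 : ∀ x, 0 < ρ x) (hz : 0 < z.im) :
    Tendsto (fun w => ∫ x in Ioi 0, (ρ x : ℂ) * (jost ρ q w x * jost ρ q z x)) (𝓝 z)
      (𝓝 (∫ x in Ioi 0, (ρ x : ℂ) * (jost ρ q z x * jost ρ q z x))) := by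
  refine tendsto_integral_filter_of_dominated_convergence
    (fun x => ρ x * Real.exp (-z.im * x) *
      ((‖amplitude hq hρ z‖ + 1) * ‖amplitude hq hρ z‖)) ?_ ?_
    ((integrableOn_weight_mul_exp hρ hz).mul_const _) ?_
  · filter_upwards [eventually_im_pos hz] with w hw
    exact aestronglyMeasurable_weight_mul_jost_mul_jost hq hρ hz hw
  · have hc := (differentiableAt_amplitude hq hρ hz).continuousAt.norm.tendsto
    filter_upwards [eventually_im_pos hz,
      hc.eventually_le_const (lt_add_one ‖amplitude hq hρ z‖)] with w hw hC
    filter_upwards [ae_restrict_mem measurableSet_Ioi] with x hx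
    exact norm_weight_mul_jost_mul_jost_le hq hρ hρ0 hz hw hC hx
  · filter_upwards [ae_restrict_mem measurableSet_Ioi] with x hx
    exact ((tendsto_jost hq hρ hz (le_of_lt hx)).mul_const _).const_mul _

/-- The asymptotics make `e` nonzero on a half-line near infinity. -/
theorem integral_weight_mul_norm_jost_sq_pos (hq : IntegrableOn q (Ioi 0))
    (hρ : IntegrableOn (fun x => 1 - ρ x) (Ioi 0)) (hρ0 : ∀ x, 0 < ρ x) (hz : 0 < z.im) :
    0 < ∫ x in Ioi 0, ρ x * ‖jost ρ q z x‖ ^ 2 := by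
  have hJ := isJostSolution_jost hq hρ hz
  have hint : IntegrableOn (fun x => ρ x * ‖jost ρ q z x‖ ^ 2) (Ioi 0) := by
    refine (integrableOn_weight_mul_jost_mul_jost hq hρ hρ0 hz hz).norm.congr
      (Eventually.of_forall fun x => ?_)
    simp only [norm_mul, Complex.norm_real, Real.norm_eq_abs, abs_of_pos (hρ0 x)]
    ring
  rw [setIntegral_pos_iff_support_of_nonneg_ae
    (Eventually.of_forall fun x => mul_nonneg (hρ0 x).le (sq_nonneg _)) hint]
  obtain ⟨X, hX⟩ := eventually_atTop.1 (hJ.tendsto.eventually_ne one_ne_zero)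
  have hsub : Ioi (max X 0) ⊆
      Function.support (fun x => ρ x * ‖jost ρ q z x‖ ^ 2) ∩ Ioi 0 := by
    intro x hx
    refine ⟨?_, (le_max_right X 0).trans_lt (mem_Ioi.1 hx)⟩
    have h1 := right_ne_zero_of_mul (hX x ((le_max_left _ _).trans (le_of_lt hx)))
    exact mul_ne_zero (hρ0 x).ne' (pow_ne_zero 2 (norm_ne_zero_iff.2 h1))
  refine lt_of_lt_of_le ?_ (measure_mono hsub)
  simp

/-- The derivative in the spectral parameter of the Wronskian-type form at `0`. -/
theorem two_mul_integral_eq_deriv (hq : IntegrableOn q (Ioi 0))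
    (hρ : IntegrableOn (fun x => 1 - ρ x) (Ioi 0)) (hρ0 : ∀ x, 0 < ρ x) (hz : 0 < z.im) :
    2 * z * ∫ x in Ioi 0, (ρ x : ℂ) * (jost ρ q z x * jost ρ q z x) =
      deriv (fun w => derivWithin (jost ρ q w) (Ici 0) 0) z * jost ρ q z 0 -
        deriv (fun w => jost ρ q w 0) z * derivWithin (jost ρ q z) (Ici 0) 0 := by
  set I : ℂ → ℂ := fun w => ∫ x in Ioi 0, (ρ x : ℂ) * (jost ρ q w x * jost ρ q z x) with hI
  have hd := ((differentiableAt_derivWithin_jost_zero hq hρ hz).hasDerivAt.mul_const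
    (jost ρ q z 0)).fun_sub ((differentiableAt_jost_zero hq hρ hz).hasDerivAt.mul_const
      (derivWithin (jost ρ q z) (Ici 0) 0))
  refine tendsto_nhds_unique ?_ (hasDerivAt_iff_tendsto_slope.1 hd)
  -- By Lagrange's identity `(w + z) I(w)` is the difference quotient at `z` of the boundary form,
  -- which vanishes at `w = z`.
  have h1 : Tendsto (fun w => (w + z) * I w) (𝓝[≠] z) (𝓝 (2 * z * I z)) := by
    rw [two_mul]
    exact Tendsto.mono_left (((continuous_id.tendsto z).add_const z).mul
      (tendsto_integral_weight_mul_jost hq hρ hρ0 hz)) nhdsWithin_le_nhds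
  refine h1.congr' ?_
  filter_upwards [self_mem_nhdsWithin, nhdsWithin_le_nhds (eventually_im_pos hz)] with w hne hw
  have h2 := lagrange_identity hw hz (isJostSolution_jost hq hρ hw) (isJostSolution_jost hq hρ hz)
    (integrableOn_weight_mul_jost_mul_jost hq hρ hρ0 hz hw)
  have hne' : w - z ≠ 0 := sub_ne_zero.2 hne
  rw [slope_def_field, ← h2, eq_div_iff hne']
  simp only [hI]
  ring

open ComplexConjugate

/-- Lagrange's identity for `e(·,z)` and its conjugate, the Jost solution at `-conj z`, with `z² -
(conj z)² = 4i Re z Im z`. -/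
theorem two_mul_re_mul_im_mul_integral_eq (hq : IntegrableOn q (Ioi 0))
    (hρ : IntegrableOn (fun x => 1 - ρ x) (Ioi 0)) (hρ0 : ∀ x, 0 < ρ x) (hz : 0 < z.im) :
    2 * z.re * z.im * ∫ x in Ioi 0, ρ x * ‖jost ρ q z x‖ ^ 2 =
      (derivWithin (jost ρ q z) (Ici 0) 0 * conj (jost ρ q z 0)).im := by
  have hJ := isJostSolution_jost hq hρ hz
  obtain ⟨hc, hdc⟩ := hJ.conj
  have hw : 0 < (-conj z).im := by simpa using hz
  have he : ∀ x, (ρ x : ℂ) * (jost ρ q z x * conj (jost ρ q z x)) =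
      ((ρ x * ‖jost ρ q z x‖ ^ 2 : ℝ) : ℂ) := fun x => by
    rw [Complex.mul_conj']
    push_cast
    ring
  have hint : IntegrableOn (fun x => (ρ x : ℂ) * (jost ρ q z x * conj (jost ρ q z x)))
      (Ioi 0) := by
    refine Integrable.mono (integrableOn_weight_mul_jost_mul_jost hq hρ hρ0 hz hz)
      ((aestronglyMeasurable_weight hρ).mul (hJ.isSolution.aestronglyMeasurable.mul
        hc.isSolution.aestronglyMeasurable)) (Eventually.of_forall fun x => ?_)
    simp
  have h := lagrange_identity hz hw hJ hc hint
  simp only [he, integral_complex_ofReal, hdc] at h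
  have h2 := congrArg Complex.im h
  set N := ∫ x in Ioi 0, ρ x * ‖jost ρ q z x‖ ^ 2
  simp [pow_two] at h2 ⊢
  linarith

/-! ### The boundary coefficients and the zeros of the characteristic function -/

theorem im_boundaryCoeff_mul_conj (A B : Fin 3 → ℝ) (z : ℂ) :
    (boundaryCoeff B z * conj (boundaryCoeff A z)).im =
      -z.re * (-(A 0 * B 1 - A 1 * B 0) - 2 * z.im * (A 0 * B 2 - A 2 * B 0) +
        (z.re ^ 2 + z.im ^ 2) * (A 1 * B 2 - A 2 * B 1)) := by
  simp [boundaryCoeff, pow_two]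
  ring

theorem differentiable_boundaryCoeff (c : Fin 3 → ℝ) : Differentiable ℂ (boundaryCoeff c) := by
  unfold boundaryCoeff
  fun_prop

theorem hasDerivAt_boundaryCoeff (c : Fin 3 → ℝ) (z : ℂ) :
    HasDerivAt (boundaryCoeff c) (Complex.I * c 1 + 2 * c 2 * z) z := by
  have h := (((hasDerivAt_id z).const_mul (Complex.I * (c 1 : ℂ))).const_add (c 0 : ℂ)).fun_add
    (((hasDerivAt_id z).fun_pow 2).const_mul (c 2 : ℂ))
  refine h.congr_deriv ?_
  simp
  ring

/-- The kernel of a nonzero linear form on `ℂ²` is a line. The formula for `c` is an orthogonal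
projection, which avoids cases on which coefficient vanishes and makes `c` real for real data. -/
theorem exists_eq_mul_of_mul_add_mul_eq_zero {P Q u v : ℂ} (h : Q * v + P * u = 0)
    (hPQ : ¬(P = 0 ∧ Q = 0)) : ∃ c : ℂ, v = c * P ∧ u = -(c * Q) ∧
      (conj P = P → conj Q = Q → conj u = u → conj v = v → conj c = c) := by
  have hn : conj P * P + conj Q * Q ≠ 0 := by
    rw [Complex.conj_mul', Complex.conj_mul']
    norm_cast
    intro h0
    have h1 := sq_nonneg ‖P‖
    have h2 := sq_nonneg ‖Q‖
    exact hPQ ⟨by simpa using (show ‖P‖ ^ 2 = 0 by linarith),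
      by simpa using (show ‖Q‖ ^ 2 = 0 by linarith)⟩
  refine ⟨(conj P * v - conj Q * u) / (conj P * P + conj Q * Q), ?_, ?_, fun h1 h2 h3 h4 => ?_⟩
  · field_simp
    linear_combination conj Q * h
  · field_simp
    linear_combination conj P * h
  · simp only [map_div₀, map_sub, map_add, map_mul, h1, h2, h3, h4]

variable {A B : Fin 3 → ℝ}

/-- At a zero `e'(0) conj e(0) = -|c|² P conj Q`, with imaginary part `-|c|² Re z K`. Hence `Re z (2
Im z N + |c|² K) = 0`, where the second factor is positive because the determinant signs give `K ≥
0`. -/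
theorem re_eq_zero_of_charFun_eq_zero (hq : IntegrableOn q (Ioi 0))
    (hρ : IntegrableOn (fun x => 1 - ρ x) (Ioi 0)) (hρ0 : ∀ x, 0 < ρ x)
    (hδ₁ : A 0 * B 1 - A 1 * B 0 ≤ 0) (hδ₂ : A 0 * B 2 - A 2 * B 0 ≤ 0)
    (hδ₃ : 0 ≤ A 1 * B 2 - A 2 * B 1) (hz : 0 < z.im)
    (hAB : ¬(boundaryCoeff A z = 0 ∧ boundaryCoeff B z = 0)) (h0 : charFun ρ q A B z = 0) :
    z.re = 0 := by
  obtain ⟨c, hv, hu, -⟩ := exists_eq_mul_of_mul_add_mul_eq_zero h0 hAB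
  have h := two_mul_re_mul_im_mul_integral_eq hq hρ hρ0 hz
  have hN := integral_weight_mul_norm_jost_sq_pos hq hρ hρ0 hz
  set N := ∫ x in Ioi 0, ρ x * ‖jost ρ q z x‖ ^ 2
  have h2 : boundaryCoeff A z * conj (boundaryCoeff B z) =
      conj (boundaryCoeff B z * conj (boundaryCoeff A z)) := by
    rw [map_mul, Complex.conj_conj, mul_comm]
  have h3 : c * boundaryCoeff A z * conj (-(c * boundaryCoeff B z)) =
      ((-‖c‖ ^ 2 : ℝ) : ℂ) * conj (boundaryCoeff B z * conj (boundaryCoeff A z)) := by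
    rw [← h2, map_neg, map_mul]
    push_cast
    rw [← Complex.mul_conj']
    ring
  rw [hv, hu, h3, Complex.im_ofReal_mul, Complex.conj_im, im_boundaryCoeff_mul_conj] at h
  have hK : 0 ≤ -(A 0 * B 1 - A 1 * B 0) - 2 * z.im * (A 0 * B 2 - A 2 * B 0) +
      (z.re ^ 2 + z.im ^ 2) * (A 1 * B 2 - A 2 * B 1) := by
    have h6 := mul_nonneg (add_nonneg (sq_nonneg z.re) (sq_nonneg z.im)) hδ₃
    nlinarith
  set K := -(A 0 * B 1 - A 1 * B 0) - 2 * z.im * (A 0 * B 2 - A 2 * B 0) +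
      (z.re ^ 2 + z.im ^ 2) * (A 1 * B 2 - A 2 * B 1)
  have h7 : z.re * (2 * z.im * N + ‖c‖ ^ 2 * K) = 0 := by linear_combination h
  refine (mul_eq_zero.1 h7).resolve_right (ne_of_gt ?_)
  positivity

theorem deriv_charFun_ne_zero (hq : IntegrableOn q (Ioi 0))
    (hρ : IntegrableOn (fun x => 1 - ρ x) (Ioi 0)) (hρ0 : ∀ x, 0 < ρ x)
    (hδ₁ : A 0 * B 1 - A 1 * B 0 ≤ 0) (hδ₂ : A 0 * B 2 - A 2 * B 0 ≤ 0)
    (hδ₃ : 0 ≤ A 1 * B 2 - A 2 * B 1) (hz : 0 < z.im)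
    (hAB : ¬(boundaryCoeff A z = 0 ∧ boundaryCoeff B z = 0)) (h0 : charFun ρ q A B z = 0) :
    deriv (charFun ρ q A B) z ≠ 0 := by
  have hre := re_eq_zero_of_charFun_eq_zero hq hρ hρ0 hδ₁ hδ₂ hδ₃ hz hAB h0
  have hJ := isJostSolution_jost hq hρ hz
  set τ := z.im with hτ
  have hzτ : z = Complex.I * τ := by
    apply Complex.ext <;> simp [hre, hτ]
  -- On the imaginary axis reflection fixes `z`, so by uniqueness `e` equals its own conjugate. The
  -- boundary coefficients are real there too.
  have hzc : -conj z = z := by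
    apply Complex.ext <;> simp [hre]
  obtain ⟨hc, hdc⟩ := hJ.conj
  rw [hzc] at hc
  obtain ⟨hreal, hreald⟩ := hc.eq_jost hq hρ hz
  rw [hdc] at hreald
  have hP : ∀ d : Fin 3 → ℝ, conj (boundaryCoeff d z) = boundaryCoeff d z := fun d => by
    have : conj z = -z := by rw [← neg_eq_iff_eq_neg, hzc]
    simp [boundaryCoeff, this]
  obtain ⟨c, hv, hu, hcr⟩ := exists_eq_mul_of_mul_add_mul_eq_zero h0 hAB
  obtain ⟨r, rfl⟩ := Complex.conj_eq_iff_real.1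
    (hcr (hP A) (hP B) (hreal 0 le_rfl) hreald)
  have hN := integral_weight_mul_norm_jost_sq_pos hq hρ hρ0 hz
  have hI : ∫ x in Ioi 0, (ρ x : ℂ) * (jost ρ q z x * jost ρ q z x) =
      ((∫ x in Ioi 0, ρ x * ‖jost ρ q z x‖ ^ 2 : ℝ) : ℂ) := by
    rw [← integral_complex_ofReal]
    refine setIntegral_congr_fun measurableSet_Ioi fun x hx => ?_
    have h1 : jost ρ q z x * jost ρ q z x = jost ρ q z x * conj (jost ρ q z x) := by
      rw [hreal x (le_of_lt hx)]
    rw [h1, Complex.mul_conj']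
    push_cast
    ring
  have hlag := two_mul_integral_eq_deriv hq hρ hρ0 hz
  rw [hI] at hlag
  set N := ∫ x in Ioi 0, ρ x * ‖jost ρ q z x‖ ^ 2
  have hE : HasDerivAt (charFun ρ q A B) _ z :=
    ((hasDerivAt_boundaryCoeff B z).fun_mul
      (differentiableAt_derivWithin_jost_zero hq hρ hz).hasDerivAt).fun_add
    ((hasDerivAt_boundaryCoeff A z).fun_mul (differentiableAt_jost_zero hq hρ hz).hasDerivAt)
  rw [hE.deriv]
  intro h
  rw [hv, hu] at hlag h
  set u' := deriv (fun w => jost ρ q w 0) z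
  set v' := deriv (fun w => derivWithin (jost ρ q w) (Ici 0) 0) z
  -- With `v = rP` and `u = -rQ`, the Lagrange expression `v'u - u'v` is `-r(Q v' + P u')`. It
  -- cancels the unknown derivatives in `r E'(z)`.
  have key : (r : ℂ) ^ 2 * ((Complex.I * B 1 + 2 * B 2 * z) * boundaryCoeff A z -
      (Complex.I * A 1 + 2 * A 2 * z) * boundaryCoeff B z) - 2 * z * N = 0 := by
    linear_combination (r : ℂ) * h - hlag
  -- At `z = iτ` the Wronskian `Q'P - P'Q` of the two coefficients is `-iK`.
  have key2 : (Complex.I * B 1 + 2 * B 2 * z) * boundaryCoeff A z -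
      (Complex.I * A 1 + 2 * A 2 * z) * boundaryCoeff B z =
      -Complex.I * ((-(A 0 * B 1 - A 1 * B 0) - 2 * τ * (A 0 * B 2 - A 2 * B 0) +
        τ ^ 2 * (A 1 * B 2 - A 2 * B 1) : ℝ) : ℂ) := by
    rw [hzτ]
    apply Complex.ext <;> simp [boundaryCoeff, pow_two] <;> ring
  have h5 : 0 ≤ -(A 0 * B 1 - A 1 * B 0) - 2 * τ * (A 0 * B 2 - A 2 * B 0) +
        τ ^ 2 * (A 1 * B 2 - A 2 * B 1) := by
    have h6 := mul_nonneg (sq_nonneg τ) hδ₃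
    nlinarith
  rw [key2] at key
  set K := -(A 0 * B 1 - A 1 * B 0) - 2 * τ * (A 0 * B 2 - A 2 * B 0) +
        τ ^ 2 * (A 1 * B 2 - A 2 * B 1)
  have key3 : ((r ^ 2 * K + 2 * τ * N : ℝ) : ℂ) = 0 := by
    push_cast
    linear_combination Complex.I * key + ((r : ℂ) ^ 2 * K + 2 * τ * N) * Complex.I_sq +
      2 * Complex.I * N * hzτ
  have h4 : 0 < r ^ 2 * K + 2 * τ * N := by positivity
  exact h4.ne' (Complex.ofReal_eq_zero.1 key3)

theorem analyticOrderAt_charFun (hq : IntegrableOn q (Ioi 0))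
    (hρ : IntegrableOn (fun x => 1 - ρ x) (Ioi 0)) (hρ0 : ∀ x, 0 < ρ x)
    (hδ₁ : A 0 * B 1 - A 1 * B 0 ≤ 0) (hδ₂ : A 0 * B 2 - A 2 * B 0 ≤ 0)
    (hδ₃ : 0 ≤ A 1 * B 2 - A 2 * B 1) (hz : 0 < z.im)
    (hAB : ¬(boundaryCoeff A z = 0 ∧ boundaryCoeff B z = 0)) (h0 : charFun ρ q A B z = 0) :
    analyticOrderAt (charFun ρ q A B) z = 1 := by
  have han : AnalyticAt ℂ (charFun ρ q A B) z := by
    rw [Complex.analyticAt_iff_eventually_differentiableAt]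
    filter_upwards [eventually_im_pos hz] with w hw
    exact ((differentiable_boundaryCoeff B w).fun_mul
      (differentiableAt_derivWithin_jost_zero hq hρ hw)).fun_add
      ((differentiable_boundaryCoeff A w).fun_mul (differentiableAt_jost_zero hq hρ hw))
  exact han.analyticOrderAt_eq_one_of_zero_deriv_ne_zero h0
    (deriv_charFun_ne_zero hq hρ hρ0 hδ₁ hδ₂ hδ₃ hz hAB h0)

/-! ### Checking the hypotheses for the piecewise constant weight -/

theorem weight_pos {α : ℝ} (hα : 0 < α) (a x : ℝ) : 0 < weight α a x := by
  unfold weight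
  split_ifs
  · positivity
  · exact one_pos

theorem integrableOn_one_sub_weight (α a : ℝ) :
    IntegrableOn (fun x => 1 - weight α a x) (Ioi 0) := by
  have h : (fun x => 1 - weight α a x) = (Iio a).indicator fun _ => 1 - α ^ 2 := by
    funext x
    by_cases hx : x < a
    · simp [weight, hx]
    · simp [weight, hx]
  rw [h, integrableOn_indicator_iff measurableSet_Iio, Iio_inter_Ioi]
  simp

/-- For `Im z > 0` the Volterra kernel is bounded, so integrability of `q` itself is the form in
which the moment condition enters. -/
theorem integrableOn_of_integrableOn_one_add_mul
    (hq : IntegrableOn (fun x : ℝ => (1 + x) * q x) (Ioi 0)) : IntegrableOn q (Ioi 0) := by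
  have h : IntegrableOn (fun x : ℝ => (1 + x)⁻¹ * ((1 + x) * q x)) (Ioi 0) := by
    refine Integrable.bdd_mul (c := 1) hq (by fun_prop) ?_
    filter_upwards [ae_restrict_mem measurableSet_Ioi] with x hx
    have hx0 : (0 : ℝ) < x := hx
    rw [norm_inv, Real.norm_eq_abs, abs_of_pos (by linarith)]
    exact inv_le_one_of_one_le₀ (by linarith)
  refine h.congr ?_
  filter_upwards [ae_restrict_mem measurableSet_Ioi] with x hx
  have hx0 : (0 : ℝ) < x := hx
  have : 1 + x ≠ 0 := by linarith
  field_simp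

end JostProblem

end

theorem mainTheorem6 (α a : ℝ) (hα : 0 < α) (hα1 : α ≠ 1) (ha : 0 < a)
    (q : ℝ → ℝ) (hq : IntegrableOn (fun x : ℝ => (1 + x) * q x) (Ioi 0) volume)
    (A B : Fin 3 → ℝ)
    (hδ₁ : A 0 * B 1 - A 1 * B 0 ≤ 0)
    (hδ₂ : A 0 * B 2 - A 2 * B 0 ≤ 0)
    (hδ₃ : 0 ≤ A 1 * B 2 - A 2 * B 1)
    (hAB : ∀ z : ℂ, 0 < z.im →
      ¬(JostProblem.boundaryCoeff A z = 0 ∧ JostProblem.boundaryCoeff B z = 0)) :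
    ∀ z : ℂ, 0 < z.im → JostProblem.charFun (JostProblem.weight α a) q A B z = 0 →
      analyticOrderAt (JostProblem.charFun (JostProblem.weight α a) q A B) z = 1 := by
  intro z hz h0
  exact JostProblem.analyticOrderAt_charFun
    (JostProblem.integrableOn_of_integrableOn_one_add_mul hq)
    (JostProblem.integrableOn_one_sub_weight α a) (JostProblem.weight_pos hα a) hδ₁ hδ₂ hδ₃ hz
    (hAB z hz) h0
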